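/- Setting. Let $k,p,n$ be integers and let $\mu_1,\dots,\mu_k$ be probability laws on $\mathbb R^p$ (Euclidean norm). Let $x_1,\dots,x_n$ be independent random vectors of $\mathbb R^p$, $x_i$ having law $\mu_{c(i)}$ for a map $c:\{1,\dots,n\}\to\{1,\dots,k\}$, and let $n_l=\#\{i: c(i)=l\}$. Put $\Sigma_l=\mathbb E[yy^T]$ for $y\sim\mu_l$, and $\gamma=p/n$, $\bar\gamma=1+\gamma$. Fix real numbers $C\ge e$, $c,q>0$, $B$, and $\kappa>0$, and assume: (1) for every $l$ and every $m\in\mathbb N$, if $Y=(y_1,\dots,y_m)$ has independent columns of law $\mu_l$ and $Y'$ is an independent copy of $Y$, then for every quasiconvex $f:\mathcal M_{p,m}\to\mathbb R$ that is 1-Lipschitz for the Frobenius norm and every $t>0$, $\mathbb P(|f(Y)-f(Y')|\ge t)\le Ce^{-t^q/c}$; (2) either $\mathbb E\|y\|\le B\sqrt p$ for $y\sim\mu_l$ and all $l$, or $q\ge2$ and $\|\mathbb E\,y\|\le B\sqrt p$ for $y\sim\mu_l$ and all $l$; (3) every class satisfies $n_l\ge\kappa\sqrt n$. For $z>0$ let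 $Q_{-l}=\big(\frac1n\sum_{j\ne i}x_jx_j^T+zI_p\big)^{-1}$, where $i$ is any one index of class $l$, and $$\delta_l=\frac1n\operatorname{tr}\big(\Sigma_l\,\mathbb E\,Q_{-l}\big),\qquad \tilde Q_d=\Big(\sum_{h=1}^k\frac{n_h}{n}\frac{\Sigma_h}{1+d_h}+zI_p\Big)^{-1}\quad(d\in\mathbb R_+^k).$$ Let $\delta'\in\mathbb R_+^k$ be the solution of the system $\delta'_l=\frac1n\operatorname{tr}(\Sigma_l\tilde Q_{\delta'})$, $1\le l\le k$. Proposition. For all constants $K$, $C\ge e$, $c,q>0$, $B$, $\kappa>0$, $G$, $Z$ there are $A>0$ and $N$, depending only on these constants, such that whenever $k\le K$, $n\ge N$, $\bar\gamma\le G$, $0<z_0<1$, $1/z_0\le Z$, $z\ge z_0$ and (1)--(3) hold, the system defining $\delta'$ has exactly one solution in $\mathbb R_+^k$, and $$\|\delta-\delta'\|_\infty\le\frac{A}{\sqrt n},\qquad \|\tilde Q_\delta-\tilde Q_{\delta'}\|\le\frac{A}{\sqrt n}$$ (the last norm being the spectral norm). -/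

import Mathlib

open MeasureTheory ProbabilityTheory

universe u

noncomputable section

/-- Convex `α`-concentration of a random vector with law `ν` in a normed space `E`: for every
`1`-Lipschitz quasiconvex `f : E → ℝ`, if `Z` has law `ν` and `Z'` is an independent copy of `Z`,
then `P(|f Z - f Z'| ≥ t) ≤ α t` for all `t > 0`. -/
def ConvexlyConcentrated {E : Type*} [NormedAddCommGroup E] [NormedSpace ℝ E] [MeasurableSpace E]
    (ν : Measure E) (α : ℝ → ℝ) : Prop :=
  ∀ f : E → ℝ, LipschitzWith 1 f → QuasiconvexOn ℝ Set.univ f →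
    ∀ t : ℝ, 0 < t → (ν.prod ν) {w | t ≤ |f w.1 - f w.2|} ≤ ENNReal.ofReal (α t)

/-- The `p × m` real matrices, seen as `m`-tuples of columns in Euclidean space. As an `ℓ²` sum of
Euclidean spaces this carries the Frobenius norm. -/
abbrev ColumnSpace (p m : ℕ) : Type := PiLp 2 (fun _ : Fin m => EuclideanSpace ℝ (Fin p))

/-- The law of the random matrix `(y₁, …, yₘ)` whose columns are independent with law `μ`. -/
def iidColumnsLaw {p : ℕ} (μ : Measure (EuclideanSpace ℝ (Fin p))) (m : ℕ) :
    Measure (ColumnSpace p m) :=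
  (Measure.pi (fun _ : Fin m => μ)).map (WithLp.toLp 2)

/-- Convex `q`-exponential concentration, in Frobenius norm and with parameters not depending on
the number of columns, of the matrices with independent columns of law `μ`. -/
def IidConvexExpConcentrated {p : ℕ} (μ : Measure (EuclideanSpace ℝ (Fin p))) (C c q : ℝ) : Prop :=
  ∀ m : ℕ, ConvexlyConcentrated (iidColumnsLaw μ m) (fun t => C * Real.exp (-(t ^ q) / c))

/-- The rank-one matrix `x xᵀ`. -/
def outerSelf {p : ℕ} (x : EuclideanSpace ℝ (Fin p)) : Matrix (Fin p) (Fin p) ℝ :=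
  Matrix.of fun a b => x a * x b

/-- The (non-centred) population covariance `Σ = E[y yᵀ]` of a vector `y` of law `μ`. -/
def popCov {p : ℕ} (μ : Measure (EuclideanSpace ℝ (Fin p))) : Matrix (Fin p) (Fin p) ℝ :=
  Matrix.of fun a b => ∫ y, outerSelf y a b ∂μ

/-- The resolvent `Q_S(z) = (S + z I)⁻¹`. -/
def resolventMat {p : ℕ} (S : Matrix (Fin p) (Fin p) ℝ) (z : ℝ) : Matrix (Fin p) (Fin p) ℝ :=
  (S + z • (1 : Matrix (Fin p) (Fin p) ℝ))⁻¹

/-- The spectral norm of a matrix: its operator norm for the Euclidean norm. -/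
def spectralNorm₂ {p : ℕ} (M : Matrix (Fin p) (Fin p) ℝ) : ℝ :=
  ‖Matrix.toEuclideanCLM (n := Fin p) (𝕜 := ℝ) M‖

/-- The sample covariance `(1/n) ∑_{j ≠ i} x_j x_jᵀ` deprived of the contribution of `x_i`
(the normalisation is still `1/n`). -/
def sampleCovWithout {p n : ℕ} (x : Fin n → EuclideanSpace ℝ (Fin p)) (i : Fin n) :
    Matrix (Fin p) (Fin p) ℝ :=
  (1 / (n : ℝ)) • ∑ j ∈ Finset.univ.erase i, outerSelf (x j)

/-- The entrywise expectation of a random matrix. -/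
def expMat {Ω : Type*} [MeasurableSpace Ω] {p : ℕ} (P : Measure Ω)
    (M : Ω → Matrix (Fin p) (Fin p) ℝ) : Matrix (Fin p) (Fin p) ℝ :=
  Matrix.of fun a b => ∫ ω, M ω a b ∂P

/-- The number `n_l` of indices in the class `l`. -/
def classSize {n k : ℕ} (cls : Fin n → Fin k) (l : Fin k) : ℕ :=
  (Finset.univ.filter fun i => cls i = l).card

/-- `δ_l = (1/n) tr (Σ_l E[Q_{-y_l}])`, where `y_l = x_{r l}` is one of the sample vectors of the
class `l`. -/
def deltaVec {Ω : Type*} [MeasurableSpace Ω] {p n k : ℕ} (P : Measure Ω)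
    (x : Fin n → Ω → EuclideanSpace ℝ (Fin p))
    (μ : Fin k → Measure (EuclideanSpace ℝ (Fin p))) (r : Fin k → Fin n) (z : ℝ) : Fin k → ℝ :=
  fun l => (1 / (n : ℝ)) * Matrix.trace (popCov (μ l) *
    expMat P (fun ω => resolventMat (sampleCovWithout (fun j => x j ω) (r l)) z))

/-- `Σ_d = ∑_l (n_l / n) Σ_l / (1 + d_l)` for a vector `d ∈ ℝᵏ`. -/
def sigmaOf {p n k : ℕ} (μ : Fin k → Measure (EuclideanSpace ℝ (Fin p))) (cls : Fin n → Fin k)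
    (d : Fin k → ℝ) : Matrix (Fin p) (Fin p) ℝ :=
  ∑ l, ((classSize cls l : ℝ) / (n : ℝ) / (1 + d l)) • popCov (μ l)

/-- `Q̃_d = (Σ_d + z I)⁻¹`. -/
def tildeQ {p n k : ℕ} (μ : Fin k → Measure (EuclideanSpace ℝ (Fin p))) (cls : Fin n → Fin k)
    (z : ℝ) (d : Fin k → ℝ) : Matrix (Fin p) (Fin p) ℝ :=
  resolventMat (sigmaOf μ cls d) z

/-- `d ∈ ℝ₊ᵏ` solves the system `d_l = (1/n) tr (Σ_l Q̃_d)`, `1 ≤ l ≤ k`. -/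
def IsDeltaPrime {p n k : ℕ} (μ : Fin k → Measure (EuclideanSpace ℝ (Fin p)))
    (cls : Fin n → Fin k) (z : ℝ) (d : Fin k → ℝ) : Prop :=
  (∀ l, 0 ≤ d l) ∧
    ∀ l, d l = (1 / (n : ℝ)) * Matrix.trace (popCov (μ l) * tildeQ μ cls z d)

end

/-! Write the system as `d = Ψ(d)` with `Ψ = deltaMap`. The proof shows that `Ψ` is stable and that
`δ` is an approximate fixed point.

Stability. If `1 + d ≤ α (1 + d')` coordinatewise with `α ≥ 1`, then `Σ_{d'} ≤ α Σ_d`, hence `Q̃_d ≤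
α Q̃_{d'}` as forms and `Ψ(d) ≤ α Ψ(d')` (`deltaMap_le_mul`). For `α = 1` this is monotonicity, and
Knaster–Tarski on a box yields a solution. Applied to the largest ratio between `1 + d` and `1 +
d'`, it shows that an `ε`-approximate solution agrees with any solution up to a factor `1 + 2ε`
(`one_add_le_of_approx`). Uniqueness is the case `ε = 0`, and both estimates follow once `|δ - Ψ(δ)|
= O(1/√n)`.

Residual. Here `n δ_l = E tr(Σ_l Q_{-l})` must be matched with `n Ψ(δ)_l = tr(Σ_l Q̃_δ)` up to
`O(√n)`. Concentration of a single column bounds the variance of convex `1`-Lipschitz functions by a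
constant `V`, so in `Σ_l = C_l + m_l m_lᵀ` the centred part `C_l` has norm at most `V`, whereas
`m_l` may have norm of order `√p`.

Mean part. The class has `n_l ≥ κ√n` columns with mean `m_l`, so the sample covariance dominates
`n_l / n` times the square of their empirical mean. This forces `E[m_l ⬝ Q m_l] = O(n / n_l) =
O(√n)` (`integral_meanVec_form_le_sqrt`). The same holds for `Q̃_δ` because `Σ_l ≥ m_l m_lᵀ`. Both
contributions are negligible separately.

Centred part. The resolvent identity writes `tr(C (Q - Q̃_δ))` as an average over columns
(`trace_resolvent_sub_eq`). Integrating first over the column `x_i`, with Sherman–Morrison removing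
it from `Q`, leaves three errors (`abs_integral_bracket_le`): a rank-one correction, the gap between
`δ` and the conditional mean of `x_i ⬝ Q_{-i} x_i / n`, and the fluctuation of that form. The second
is controlled by a bounded-differences variance bound for `tr(C Q)`, the third by concentration of
the convex Lipschitz function `√(y ⬝ A y)`. -/

open Matrix

/-! ### Positive semidefinite forms and matrices with `z A² ≤ A`. -/

section LinearAlgebra

variable {p : ℕ}

theorem posSemidef_real_iff {M : Matrix (Fin p) (Fin p) ℝ} :
    M.PosSemidef ↔ Mᵀ = M ∧ ∀ v : Fin p → ℝ, 0 ≤ v ⬝ᵥ M *ᵥ v := by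
  rw [posSemidef_iff_dotProduct_mulVec]
  simp [IsHermitian, conjTranspose_eq_transpose_of_trivial]

theorem dotProduct_mulVec_comm_of_symm {M : Matrix (Fin p) (Fin p) ℝ} (hM : Mᵀ = M)
    (u v : Fin p → ℝ) : u ⬝ᵥ M *ᵥ v = v ⬝ᵥ M *ᵥ u := by
  conv_lhs => rw [← hM]
  rw [dotProduct_transpose_mulVec]

theorem mulVec_dotProduct_of_symm {M : Matrix (Fin p) (Fin p) ℝ} (hM : Mᵀ = M)
    (u v : Fin p → ℝ) : (M *ᵥ u) ⬝ᵥ v = u ⬝ᵥ M *ᵥ v := by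
  rw [dotProduct_comm, dotProduct_mulVec_comm_of_symm hM]

theorem Matrix.PosSemidef.symm_real {M : Matrix (Fin p) (Fin p) ℝ} (hM : M.PosSemidef) :
    Mᵀ = M := (posSemidef_real_iff.1 hM).1

theorem Matrix.PosSemidef.nonneg_real {M : Matrix (Fin p) (Fin p) ℝ} (hM : M.PosSemidef)
    (v : Fin p → ℝ) : 0 ≤ v ⬝ᵥ M *ᵥ v := (posSemidef_real_iff.1 hM).2 v

/-- Cauchy-Schwarz for a positive semidefinite form. -/
theorem Matrix.PosSemidef.sq_dotProduct_mulVec_le {M : Matrix (Fin p) (Fin p) ℝ}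
    (hM : M.PosSemidef) (u v : Fin p → ℝ) :
    (u ⬝ᵥ M *ᵥ v) ^ 2 ≤ (u ⬝ᵥ M *ᵥ u) * (v ⬝ᵥ M *ᵥ v) := by
  have h : ∀ t : ℝ, 0 ≤ (u ⬝ᵥ M *ᵥ u) * (t * t) + (2 * (u ⬝ᵥ M *ᵥ v)) * t + v ⬝ᵥ M *ᵥ v := by
    intro t
    have := hM.nonneg_real (t • u + v)
    simp only [mulVec_add, mulVec_smul, dotProduct_add, add_dotProduct, smul_dotProduct,
      dotProduct_smul, smul_eq_mul, dotProduct_mulVec_comm_of_symm hM.symm_real v u] at this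
    linarith
  have := discrim_le_zero h
  rw [discrim] at this
  linarith

theorem Matrix.PosSemidef.abs_dotProduct_mulVec_le {M : Matrix (Fin p) (Fin p) ℝ}
    (hM : M.PosSemidef) (u v : Fin p → ℝ) :
    |u ⬝ᵥ M *ᵥ v| ≤ √(u ⬝ᵥ M *ᵥ u) * √(v ⬝ᵥ M *ᵥ v) := by
  rw [← Real.sqrt_mul (hM.nonneg_real u), ← Real.sqrt_sq_eq_abs]
  exact Real.sqrt_le_sqrt (hM.sq_dotProduct_mulVec_le u v)

theorem abs_dotProduct_le_sqrt (u v : Fin p → ℝ) : |u ⬝ᵥ v| ≤ √(u ⬝ᵥ u) * √(v ⬝ᵥ v) := by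
  simpa using (PosSemidef.one (n := Fin p) (R := ℝ)).abs_dotProduct_mulVec_le u v

theorem dotProduct_self_nonneg_real (u : Fin p → ℝ) : 0 ≤ u ⬝ᵥ u :=
  Finset.sum_nonneg fun i _ => mul_self_nonneg (u i)

/-- The semi-norm attached to a positive semidefinite form satisfies the triangle inequality. -/
theorem Matrix.PosSemidef.sqrt_add_le {M : Matrix (Fin p) (Fin p) ℝ} (hM : M.PosSemidef)
    (u v : Fin p → ℝ) :
    √((u + v) ⬝ᵥ M *ᵥ (u + v)) ≤ √(u ⬝ᵥ M *ᵥ u) + √(v ⬝ᵥ M *ᵥ v) := by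
  apply Real.sqrt_le_iff.2 ⟨by positivity, ?_⟩
  have h := (le_abs_self _).trans (hM.abs_dotProduct_mulVec_le u v)
  have h1 := Real.sq_sqrt (hM.nonneg_real u)
  have h2 := Real.sq_sqrt (hM.nonneg_real v)
  simp only [mulVec_add, dotProduct_add, add_dotProduct,
    dotProduct_mulVec_comm_of_symm hM.symm_real v u]
  nlinarith

theorem Matrix.PosSemidef.add_form_le {M : Matrix (Fin p) (Fin p) ℝ} (hM : M.PosSemidef)
    (u v : Fin p → ℝ) :
    (u + v) ⬝ᵥ M *ᵥ (u + v) ≤ 2 * (u ⬝ᵥ M *ᵥ u) + 2 * (v ⬝ᵥ M *ᵥ v) := by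
  have := hM.nonneg_real (u - v)
  simp only [mulVec_sub, dotProduct_sub, sub_dotProduct, mulVec_add, dotProduct_add,
    add_dotProduct] at this ⊢
  linarith

/-- Symmetric matrices `A` with `z A² ≤ A`. -/
structure IsResolventBound (z : ℝ) (A : Matrix (Fin p) (Fin p) ℝ) : Prop where
  symm : Aᵀ = A
  coercive : ∀ y : Fin p → ℝ, z * ((A *ᵥ y) ⬝ᵥ (A *ᵥ y)) ≤ y ⬝ᵥ A *ᵥ y

namespace IsResolventBound

variable {z : ℝ} {A : Matrix (Fin p) (Fin p) ℝ}

theorem posSemidef (hA : IsResolventBound z A) (hz : 0 < z) : A.PosSemidef :=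
  posSemidef_real_iff.2 ⟨hA.symm, fun v =>
    (mul_nonneg hz.le (dotProduct_self_nonneg_real _)).trans (hA.coercive v)⟩

theorem mulVec_self_le (hA : IsResolventBound z A) (hz : 0 < z) (y : Fin p → ℝ) :
    (A *ᵥ y) ⬝ᵥ (A *ᵥ y) ≤ (y ⬝ᵥ A *ᵥ y) / z := by
  rw [le_div_iff₀' hz]; exact hA.coercive y

/-- Cauchy–Schwarz and coercivity give `z (y ⬝ A y)² ≤ |y|² (y ⬝ A y)`; one factor `y ⬝ A y` is then
cancelled, the case where it vanishes being trivial. -/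
theorem form_le (hA : IsResolventBound z A) (hz : 0 < z) (y : Fin p → ℝ) :
    y ⬝ᵥ A *ᵥ y ≤ (y ⬝ᵥ y) / z := by
  have h1 := hA.coercive y
  have h2 := (PosSemidef.one (n := Fin p) (R := ℝ)).sq_dotProduct_mulVec_le y (A *ᵥ y)
  simp only [one_mulVec] at h2
  have h3 := (hA.posSemidef hz).nonneg_real y
  rw [le_div_iff₀' hz]
  rcases h3.eq_or_lt with h0 | h0
  · rw [← h0]; simpa using dotProduct_self_nonneg_real y
  · refine le_of_mul_le_mul_right ?_ h0
    have := mul_le_mul_of_nonneg_left h1 (dotProduct_self_nonneg_real y)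
    nlinarith

theorem mulVec_self_le_sq (hA : IsResolventBound z A) (hz : 0 < z) (y : Fin p → ℝ) :
    (A *ᵥ y) ⬝ᵥ (A *ᵥ y) ≤ (y ⬝ᵥ y) / z ^ 2 := by
  refine (hA.mulVec_self_le hz y).trans ?_
  rw [pow_two, ← div_div]
  exact div_le_div_of_nonneg_right (hA.form_le hz y) hz.le

/-- Serves only to make traces against resolvents bounded, hence integrable; its value never enters
the final constants. -/
theorem abs_apply_le (hA : IsResolventBound z A) (hz : 0 < z) (a b : Fin p) :
    |A a b| ≤ 1 / z := by
  have h := (hA.posSemidef hz).abs_dotProduct_mulVec_le (Pi.single a 1) (Pi.single b 1)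
  have ha := hA.form_le hz (Pi.single a 1)
  have hb := hA.form_le hz (Pi.single b 1)
  simp only [single_one_dotProduct, mulVec_single_one, Pi.single_eq_same, col_apply] at h ha hb
  refine h.trans ((mul_le_mul (Real.sqrt_le_sqrt ha) (Real.sqrt_le_sqrt hb)
    (Real.sqrt_nonneg _) (Real.sqrt_nonneg _)).trans ?_)
  rw [Real.mul_self_sqrt (by positivity)]

end IsResolventBound

/-! ### Order properties and rank-one perturbations of `(S + z)⁻¹`. -/

section Resolvent

variable {S S' : Matrix (Fin p) (Fin p) ℝ} {z : ℝ}

theorem isUnit_add_smul_one (hS : S.PosSemidef) (hz : 0 < z) :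
    IsUnit (S + z • (1 : Matrix (Fin p) (Fin p) ℝ)) :=
  (PosDef.posSemidef_add hS (PosDef.one.smul hz)).isUnit

theorem mul_resolventMat (hS : S.PosSemidef) (hz : 0 < z) :
    (S + z • (1 : Matrix (Fin p) (Fin p) ℝ)) * resolventMat S z = 1 :=
  Matrix.mul_nonsing_inv _ ((isUnit_iff_isUnit_det _).1 (isUnit_add_smul_one hS hz))

theorem resolventMat_mul (hS : S.PosSemidef) (hz : 0 < z) :
    resolventMat S z * (S + z • (1 : Matrix (Fin p) (Fin p) ℝ)) = 1 :=
  Matrix.nonsing_inv_mul _ ((isUnit_iff_isUnit_det _).1 (isUnit_add_smul_one hS hz))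

theorem add_smul_resolventMat_mulVec (hS : S.PosSemidef) (hz : 0 < z) (y : Fin p → ℝ) :
    S *ᵥ (resolventMat S z *ᵥ y) + z • (resolventMat S z *ᵥ y) = y := by
  have := congrArg (· *ᵥ y) (mul_resolventMat hS hz)
  simpa [← mulVec_mulVec, add_mulVec, smul_mulVec] using this

theorem resolventMat_symm (hS : S.PosSemidef) : (resolventMat S z)ᵀ = resolventMat S z := by
  rw [resolventMat, transpose_nonsing_inv]
  simp [hS.symm_real]

/-- `y ⬝ Q y = v ⬝ S v + z ‖v‖²` for `v = Q y`. -/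
theorem dotProduct_resolventMat_mulVec (hS : S.PosSemidef) (hz : 0 < z) (y : Fin p → ℝ) :
    y ⬝ᵥ resolventMat S z *ᵥ y = (resolventMat S z *ᵥ y) ⬝ᵥ S *ᵥ (resolventMat S z *ᵥ y) +
      z * ((resolventMat S z *ᵥ y) ⬝ᵥ (resolventMat S z *ᵥ y)) := by
  set w := resolventMat S z *ᵥ y with hw
  have h : S *ᵥ w + z • w = y := add_smul_resolventMat_mulVec hS hz y
  rw [← h, add_dotProduct, smul_dotProduct, smul_eq_mul, mulVec_dotProduct_of_symm hS.symm_real]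

theorem isResolventBound_resolventMat (hS : S.PosSemidef) (hz : 0 < z) :
    IsResolventBound z (resolventMat S z) :=
  ⟨resolventMat_symm hS, fun y => by
    rw [dotProduct_resolventMat_mulVec hS hz y]
    linarith [hS.nonneg_real (resolventMat S z *ᵥ y)]⟩

/-- Variational description of the inverse: the difference of the two sides is the form of `S + z`
at `v - w`, where `w = (S + z)⁻¹ y`. It makes inversion order-reversing without matrix square roots.
-/
theorem two_mul_sub_form_le_resolventMat (hS : S.PosSemidef) (hz : 0 < z) (v y : Fin p → ℝ) :
    2 * (v ⬝ᵥ y) - (v ⬝ᵥ S *ᵥ v + z * (v ⬝ᵥ v)) ≤ y ⬝ᵥ resolventMat S z *ᵥ y := by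
  set w := resolventMat S z *ᵥ y with hw
  have h0 := dotProduct_resolventMat_mulVec hS hz y
  have h1 := hS.nonneg_real (v - w)
  have h2 := mul_nonneg hz.le (dotProduct_self_nonneg_real (v - w))
  have h3 : v ⬝ᵥ y = v ⬝ᵥ S *ᵥ w + z * (v ⬝ᵥ w) := by
    conv_lhs => rw [← add_smul_resolventMat_mulVec hS hz y]
    simp [dotProduct_add, hw]
  rw [← hw] at h0
  simp only [mulVec_sub, dotProduct_sub, sub_dotProduct,
    dotProduct_mulVec_comm_of_symm hS.symm_real w v, dotProduct_comm w v] at h1 h2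
  linarith

/-- If `S' + z ≤ α (S + z)` then `(S + z)⁻¹ ≤ α (S' + z)⁻¹`. -/
theorem resolventMat_form_le (hS : S.PosSemidef) (hS' : S'.PosSemidef) (hz : 0 < z) {α : ℝ}
    (hα : 0 < α) (h : ∀ v : Fin p → ℝ,
      v ⬝ᵥ S' *ᵥ v + z * (v ⬝ᵥ v) ≤ α * (v ⬝ᵥ S *ᵥ v + z * (v ⬝ᵥ v))) (y : Fin p → ℝ) :
    y ⬝ᵥ resolventMat S z *ᵥ y ≤ α * (y ⬝ᵥ resolventMat S' z *ᵥ y) := by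
  set w := resolventMat S z *ᵥ y with hw
  have h0 := dotProduct_resolventMat_mulVec hS hz y
  -- The test vector `α⁻¹ w` is the one for which the loss `α` in the hypothesis is exactly
  -- absorbed.
  have h1 := two_mul_sub_form_le_resolventMat hS' hz (α⁻¹ • w) y
  have h2 := h w
  simp only [mulVec_smul, smul_dotProduct, dotProduct_smul, smul_eq_mul] at h1
  rw [← hw] at h0
  have h3 : α * (2 * (α⁻¹ * (w ⬝ᵥ y)) - (α⁻¹ * (α⁻¹ * (w ⬝ᵥ S' *ᵥ w)) +
      z * (α⁻¹ * (α⁻¹ * (w ⬝ᵥ w))))) = 2 * (w ⬝ᵥ y) -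
      (w ⬝ᵥ S' *ᵥ w + z * (w ⬝ᵥ w)) / α := by
    field_simp
  have h4 := mul_le_mul_of_nonneg_left h1 hα.le
  rw [h3] at h4
  have h5 := (div_le_iff₀' hα).2 h2
  rw [dotProduct_comm w y] at h4
  linarith

/-- If `a (v ⬝ u)² ≤ v ⬝ S v` for all `v`, then `u ⬝ (S + z)⁻¹ u ≤ 1 / a`. -/
theorem resolventMat_form_le_inv (hS : S.PosSemidef) (hz : 0 < z) {a : ℝ} (ha : 0 < a)
    {u : Fin p → ℝ} (h : ∀ v : Fin p → ℝ, a * (v ⬝ᵥ u) ^ 2 ≤ v ⬝ᵥ S *ᵥ v) :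
    u ⬝ᵥ resolventMat S z *ᵥ u ≤ 1 / a := by
  have h0 := dotProduct_resolventMat_mulVec hS hz u
  have h1 := h (resolventMat S z *ᵥ u)
  have h2 := mul_nonneg hz.le (dotProduct_self_nonneg_real (resolventMat S z *ᵥ u))
  rw [dotProduct_comm _ u] at h1
  rw [le_div_iff₀' ha]
  -- With `v = (S + z)⁻¹ u`, the hypothesis reads `a t² ≤ v ⬝ S v`, and `v ⬝ S v ≤ t`.
  set t := u ⬝ᵥ resolventMat S z *ᵥ u
  by_contra! hc
  have : 0 < t := by by_contra! h'; nlinarith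
  nlinarith

/-- Sherman–Morrison, checked by multiplying the proposed inverse by `S + z + a x xᵀ`. -/
theorem resolventMat_add_vecMulVec (hS : S.PosSemidef) (hz : 0 < z) {a : ℝ} (ha : 0 ≤ a)
    (x : Fin p → ℝ) :
    resolventMat (S + a • vecMulVec x x) z = resolventMat S z -
      (a / (1 + a * (x ⬝ᵥ resolventMat S z *ᵥ x))) •
        vecMulVec (resolventMat S z *ᵥ x) (resolventMat S z *ᵥ x) := by
  set R := resolventMat S z with hR
  set D := x ⬝ᵥ R *ᵥ x with hD
  have hD0 : 0 ≤ D := ((isResolventBound_resolventMat hS hz).posSemidef hz).nonneg_real x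
  have hD1 : 1 + a * D ≠ 0 := by positivity
  have hMw : (S + z • (1 : Matrix (Fin p) (Fin p) ℝ)) *ᵥ (R *ᵥ x) = x := by
    rw [mulVec_mulVec, mul_resolventMat hS hz, one_mulVec]
  have hxR : x ᵥ* R = R *ᵥ x := by rw [← vecMul_transpose, resolventMat_symm hS]
  rw [resolventMat]
  apply Matrix.inv_eq_right_inv
  have e : S + a • vecMulVec x x + z • (1 : Matrix (Fin p) (Fin p) ℝ) =
    (S + z • (1 : Matrix (Fin p) (Fin p) ℝ)) + a • vecMulVec x x := by abel
  rw [e, add_mul, mul_sub, mul_sub, mul_resolventMat hS hz, Matrix.mul_smul, Matrix.mul_smul,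
    mul_vecMulVec, hMw, Matrix.smul_mul, Matrix.smul_mul, vecMulVec_mul, hxR,
    vecMulVec_mul_vecMulVec, ← hD]
  ext i j
  simp only [Matrix.add_apply, Matrix.sub_apply, Matrix.smul_apply, vecMulVec_apply,
    smul_eq_mul, Pi.smul_apply]
  field_simp
  ring

theorem resolventMat_add_vecMulVec_mulVec (hS : S.PosSemidef) (hz : 0 < z) {a : ℝ} (ha : 0 ≤ a)
    (x : Fin p → ℝ) :
    resolventMat (S + a • vecMulVec x x) z *ᵥ x =
      (1 / (1 + a * (x ⬝ᵥ resolventMat S z *ᵥ x))) • (resolventMat S z *ᵥ x) := by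
  have hD0 : 0 ≤ x ⬝ᵥ resolventMat S z *ᵥ x :=
    ((isResolventBound_resolventMat hS hz).posSemidef hz).nonneg_real x
  have hD1 : 1 + a * (x ⬝ᵥ resolventMat S z *ᵥ x) ≠ 0 := by positivity
  rw [resolventMat_add_vecMulVec hS hz ha, sub_mulVec, smul_mulVec, vecMulVec_mulVec]
  ext i
  simp only [Pi.sub_apply, Pi.smul_apply, smul_eq_mul, MulOpposite.smul_eq_mul_unop,
    MulOpposite.unop_op, dotProduct_comm (resolventMat S z *ᵥ x) x]
  field_simp
  ring

end Resolvent

theorem trace_mul_vecMulVec_eq (M : Matrix (Fin p) (Fin p) ℝ) (u v : Fin p → ℝ) :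
    (M * vecMulVec u v).trace = v ⬝ᵥ M *ᵥ u := by
  rw [mul_vecMulVec, trace_vecMulVec, dotProduct_comm]

end LinearAlgebra

/-! ### From exponential concentration to variance and second-moment bounds. -/

section Law

/-- A law on `ℝᵖ` with finite second moment, under which every convex `1`-Lipschitz function has
variance at most `V`. -/
structure HasLipschitzVariance {p : ℕ} (μ : Measure (EuclideanSpace ℝ (Fin p))) (V : ℝ) :
    Prop where
  memLp_id : MemLp id 2 μ
  variance_le : ∀ f : EuclideanSpace ℝ (Fin p) → ℝ, LipschitzWith 1 f →
    ConvexOn ℝ Set.univ f → Var[f; μ] ≤ V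

theorem variance_le_integral_sub_sq {Ω : Type*} [MeasurableSpace Ω] {P : Measure Ω}
    [IsProbabilityMeasure P] {f : Ω → ℝ} (hf : AEStronglyMeasurable f P) (a : ℝ) :
    Var[f; P] ≤ ∫ ω, (f ω - a) ^ 2 ∂P := by
  rw [← variance_sub_const hf a]
  exact variance_le_expectation_sq (hf.sub aestronglyMeasurable_const)

theorem measurePreserving_iidColumnsLaw_one {p : ℕ} (μ : Measure (EuclideanSpace ℝ (Fin p)))
    [IsProbabilityMeasure μ] :
    MeasurePreserving (fun w : ColumnSpace p 1 => w 0) (iidColumnsLaw μ 1) μ := by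
  have h1 : MeasurePreserving (WithLp.toLp 2) (Measure.pi (fun _ : Fin 1 => μ))
      (iidColumnsLaw μ 1) := ⟨WithLp.measurable_toLp 2 _, rfl⟩
  have h2 := measurePreserving_eval (fun _ : Fin 1 => μ) 0
  have hm : Measurable (fun w : ColumnSpace p 1 => w 0) :=
    (measurable_pi_apply 0).comp (WithLp.measurable_ofLp 2 _)
  refine ⟨hm, ?_⟩
  rw [← h1.map_eq, Measure.map_map hm h1.measurable]
  exact h2.map_eq

/-- Layer-cake formula for two independent copies, with the tail bound for one-column matrices
inserted. -/
theorem lintegral_sub_sq_prod_le {p : ℕ} {μ : Measure (EuclideanSpace ℝ (Fin p))}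
    [IsProbabilityMeasure μ] {C c q : ℝ} (h : IidConvexExpConcentrated μ C c q)
    {f : EuclideanSpace ℝ (Fin p) → ℝ} (hf : LipschitzWith 1 f) (hq : ConvexOn ℝ Set.univ f) :
    ∫⁻ w, ENNReal.ofReal ((f w.1 - f w.2) ^ 2) ∂(μ.prod μ) ≤
      ENNReal.ofReal 2 * ∫⁻ t in Set.Ioi (0 : ℝ),
        ENNReal.ofReal (C * Real.exp (-(t ^ q) / c)) * ENNReal.ofReal t := by
  have hmp := measurePreserving_iidColumnsLaw_one μ
  have : IsProbabilityMeasure (iidColumnsLaw μ 1) := by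
    constructor
    have := hmp.measure_preimage (s := Set.univ) MeasurableSet.univ.nullMeasurableSet
    simpa using this
  have hfm : Measurable f := hf.continuous.measurable
  have hgm : Measurable fun w : EuclideanSpace ℝ (Fin p) × EuclideanSpace ℝ (Fin p) =>
      |f w.1 - f w.2| := by
    have : Measurable fun w : EuclideanSpace ℝ (Fin p) × EuclideanSpace ℝ (Fin p) =>
      f w.1 - f w.2 := (hfm.comp measurable_fst).sub (hfm.comp measurable_snd)
    exact this.norm
  have key := lintegral_rpow_eq_lintegral_meas_le_mul (μ := μ.prod μ)
    (f := fun w => |f w.1 - f w.2|) (Filter.Eventually.of_forall fun w => abs_nonneg _)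
    hgm.aemeasurable (p := 2) two_pos
  have e : ∀ w : EuclideanSpace ℝ (Fin p) × EuclideanSpace ℝ (Fin p),
      (f w.1 - f w.2) ^ 2 = |f w.1 - f w.2| ^ (2 : ℝ) := by
    intro w; rw [Real.rpow_two, sq_abs]
  simp_rw [e]
  rw [key]
  gcongr ENNReal.ofReal 2 * ?_
  refine setLIntegral_mono' measurableSet_Ioi fun t ht => ?_
  have e1 : (2 : ℝ) - 1 = 1 := by norm_num
  rw [e1, Real.rpow_one]
  gcongr
  have hc := h 1 (fun w => f (w 0)) ?_ ?_ t ht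
  · refine le_trans (le_of_eq ?_) hc
    have := (hmp.prod hmp).measure_preimage
      (s := {w | t ≤ |f w.1 - f w.2|}) (measurableSet_le measurable_const hgm).nullMeasurableSet
    rw [← this]; rfl
  · refine LipschitzWith.of_dist_le_mul fun v w => (hf.dist_le_mul _ _).trans ?_
    simp only [NNReal.coe_one, one_mul, dist_eq_norm]
    exact PiLp.norm_apply_le (v - w) 0
  · have hc : ConvexOn ℝ Set.univ (fun w : ColumnSpace p 1 => f (w 0)) := by
      refine ⟨convex_univ, fun v _ w _ a b ha hb hab => ?_⟩
      simpa using hq.2 (Set.mem_univ (v 0)) (Set.mem_univ (w 0)) ha hb hab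
    exact hc.quasiconvexOn

theorem exists_lipschitzVariance (C c q : ℝ) (hC : 0 ≤ C) (hc : 0 < c) (hq : 0 < q) :
    ∃ V : ℝ, 0 ≤ V ∧ ∀ (p : ℕ) (μ : Measure (EuclideanSpace ℝ (Fin p))) [IsProbabilityMeasure μ],
      IidConvexExpConcentrated μ C c q → HasLipschitzVariance μ V := by
  set I : ENNReal := ENNReal.ofReal 2 * ∫⁻ t in Set.Ioi (0 : ℝ),
        ENNReal.ofReal (C * Real.exp (-(t ^ q) / c)) * ENNReal.ofReal t with hI
  have hfin : I ≠ ⊤ := by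
    refine ENNReal.mul_ne_top ENNReal.ofReal_ne_top ?_
    have h1 := (integrableOn_rpow_mul_exp_neg_mul_rpow (p := q) (s := 1) (b := 1 / c)
      (by norm_num) hq (by positivity)).const_mul C
    have h2 := h1.lintegral_lt_top
    refine (lt_of_le_of_lt ?_ h2).ne
    refine setLIntegral_mono' measurableSet_Ioi fun t ht => ?_
    rw [← ENNReal.ofReal_mul (by positivity)]
    apply le_of_eq
    congr 1
    rw [Real.rpow_one]
    have : -(t ^ q) / c = -(1 / c) * t ^ q := by ring
    rw [this]; ring
  refine ⟨I.toReal, ENNReal.toReal_nonneg, fun p μ _ h => ?_⟩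
  have key : ∀ f : EuclideanSpace ℝ (Fin p) → ℝ, LipschitzWith 1 f → ConvexOn ℝ Set.univ f →
      MemLp f 2 μ ∧ Var[f; μ] ≤ I.toReal := by
    intro f hf hfc
    have hfm : Measurable f := hf.continuous.measurable
    have h1 := lintegral_sub_sq_prod_le h hf hfc
    have hm : Measurable fun w : EuclideanSpace ℝ (Fin p) × EuclideanSpace ℝ (Fin p) =>
        ENNReal.ofReal ((f w.2 - f w.1) ^ 2) :=
      (((hfm.comp measurable_snd).sub (hfm.comp measurable_fst)).pow_const 2).ennreal_ofReal
    have h2 : ∫⁻ x, ∫⁻ y, ENNReal.ofReal ((f y - f x) ^ 2) ∂μ ∂μ ≤ I := by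
      rw [← lintegral_prod _ hm.aemeasurable]
      refine le_trans (le_of_eq ?_) h1
      congr with w
      rw [← neg_sq]; ring_nf
    -- No integrability of `f` is known yet. A centre `f x` whose mean square deviation is at most
    -- its average over `x` exists anyway, and it gives both `f ∈ L²` and the variance bound.
    obtain ⟨x, hx⟩ := exists_le_lintegral (μ := μ)
      (f := fun x => ∫⁻ y, ENNReal.ofReal ((f y - f x) ^ 2) ∂μ) hm.lintegral_prod_right'.aemeasurable
    have h3 := hx.trans h2
    have hsq : Integrable (fun y => (f y - f x) ^ 2) μ := by
      refine ⟨((hfm.sub_const _).pow_const 2).aestronglyMeasurable, ?_⟩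
      rw [hasFiniteIntegral_iff_ofReal (Filter.Eventually.of_forall fun y => sq_nonneg _)]
      exact lt_of_le_of_lt h3 hfin.lt_top
    have hL : MemLp (fun y => f y - f x) 2 μ :=
      (memLp_two_iff_integrable_sq (hfm.sub_const _).aestronglyMeasurable).2 hsq
    refine ⟨?_, ?_⟩
    · have := hL.add (memLp_const (f x))
      refine this.ae_eq (Filter.Eventually.of_forall fun y => ?_)
      simp
    · refine (variance_le_integral_sub_sq hfm.aestronglyMeasurable (f x)).trans ?_
      rw [integral_eq_lintegral_of_nonneg_ae (Filter.Eventually.of_forall fun y => sq_nonneg _)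
        hsq.aestronglyMeasurable]
      exact ENNReal.toReal_mono hfin h3
  refine ⟨?_, fun f hf hfc => (key f hf hfc).2⟩
  -- The norm is itself convex and `1`-Lipschitz, so the law has a second moment.
  have := (key norm lipschitzWith_one_norm (convexOn_norm convex_univ)).1
  exact (memLp_norm_iff aestronglyMeasurable_id).1 this

variable {p : ℕ} {μ : Measure (EuclideanSpace ℝ (Fin p))} {V : ℝ}

theorem outerSelf_eq_vecMulVec (x : EuclideanSpace ℝ (Fin p)) :
    outerSelf x = vecMulVec x.ofLp x.ofLp := rfl

theorem norm_sq_eq_dotProduct (x : EuclideanSpace ℝ (Fin p)) : ‖x‖ ^ 2 = x.ofLp ⬝ᵥ x.ofLp := by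
  rw [EuclideanSpace.real_norm_sq_eq]
  simp [dotProduct, pow_two]

theorem memLp_apply (hμ : MemLp id 2 μ) (a : Fin p) :
    MemLp (fun y : EuclideanSpace ℝ (Fin p) => y a) 2 μ :=
  MemLp.continuousLinearMap_comp hμ (EuclideanSpace.proj (𝕜 := ℝ) a)

theorem memLp_dotProduct (hμ : MemLp id 2 μ) (v : Fin p → ℝ) :
    MemLp (fun y : EuclideanSpace ℝ (Fin p) => v ⬝ᵥ y.ofLp) 2 μ := by
  simp only [dotProduct]
  exact memLp_finsetSum _ fun a _ => (memLp_apply hμ a).const_mul (v a)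

theorem integrable_apply_mul_apply (hμ : MemLp id 2 μ) (a b : Fin p) :
    Integrable (fun y : EuclideanSpace ℝ (Fin p) => y a * y b) μ :=
  (memLp_apply hμ a).integrable_mul (memLp_apply hμ b)

theorem integrable_form (hμ : MemLp id 2 μ) (N : Matrix (Fin p) (Fin p) ℝ) :
    Integrable (fun y : EuclideanSpace ℝ (Fin p) => y.ofLp ⬝ᵥ N *ᵥ y.ofLp) μ := by
  simp only [dotProduct, mulVec, Finset.mul_sum]
  refine integrable_finsetSum _ fun a _ => integrable_finsetSum _ fun b _ => ?_
  refine ((integrable_apply_mul_apply hμ a b).const_mul (N a b)).congr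
    (Filter.Eventually.of_forall fun y => ?_)
  simp only; ring

theorem trace_popCov_mul (hμ : MemLp id 2 μ) (N : Matrix (Fin p) (Fin p) ℝ) :
    (popCov μ * N).trace = ∫ y, y.ofLp ⬝ᵥ N *ᵥ y.ofLp ∂μ := by
  have e : ∀ y : EuclideanSpace ℝ (Fin p), y.ofLp ⬝ᵥ N *ᵥ y.ofLp =
      ∑ a, ∑ b, y b * y a * N a b := by
    intro y
    simp only [dotProduct, mulVec, Finset.mul_sum]
    exact Finset.sum_congr rfl fun a _ => Finset.sum_congr rfl fun b _ => by ring
  simp_rw [e]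
  have hi : ∀ a b, Integrable (fun y : EuclideanSpace ℝ (Fin p) => y b * y a * N a b) μ :=
    fun a b => (integrable_apply_mul_apply hμ b a).mul_const _
  rw [integral_finsetSum Finset.univ fun a _ => integrable_finsetSum Finset.univ fun b _ => hi a b]
  rw [trace_mul_comm]
  simp only [trace, diag_apply, Matrix.mul_apply]
  refine Finset.sum_congr rfl fun a _ => ?_
  rw [integral_finsetSum Finset.univ fun b _ => hi a b]
  refine Finset.sum_congr rfl fun b _ => ?_
  rw [integral_mul_const, mul_comm]
  rfl

theorem dotProduct_popCov_mulVec (hμ : MemLp id 2 μ) (u v : Fin p → ℝ) :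
    u ⬝ᵥ popCov μ *ᵥ v = ∫ y, (u ⬝ᵥ y.ofLp) * (v ⬝ᵥ y.ofLp) ∂μ := by
  rw [← trace_mul_vecMulVec_eq, trace_popCov_mul hμ]
  congr with y
  rw [vecMulVec_mulVec]
  simp [dotProduct_comm]

theorem popCov_posSemidef (hμ : MemLp id 2 μ) : (popCov μ).PosSemidef := by
  refine posSemidef_real_iff.2 ⟨?_, fun v => ?_⟩
  · ext a b
    simp only [transpose_apply, popCov, of_apply, outerSelf, mul_comm]
  · rw [dotProduct_popCov_mulVec hμ]
    exact integral_nonneg fun y => mul_self_nonneg _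

/-- The mean of a law, as a plain vector. -/
noncomputable def meanVec (μ : Measure (EuclideanSpace ℝ (Fin p))) : Fin p → ℝ :=
  fun a => ∫ y, y a ∂μ

/-- The centred covariance matrix. -/
noncomputable def covMat (μ : Measure (EuclideanSpace ℝ (Fin p))) : Matrix (Fin p) (Fin p) ℝ :=
  popCov μ - vecMulVec (meanVec μ) (meanVec μ)

theorem popCov_eq_add (μ : Measure (EuclideanSpace ℝ (Fin p))) :
    popCov μ = covMat μ + vecMulVec (meanVec μ) (meanVec μ) := by simp [covMat]

theorem HasLipschitzVariance.nonneg (h : HasLipschitzVariance μ V) : 0 ≤ V :=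
  (variance_nonneg _ _).trans (h.variance_le norm lipschitzWith_one_norm
    (convexOn_norm convex_univ))

/-- A quadratic form is not Lipschitz, but its square root is a seminorm dominated by `|y| / √z`,
hence convex and Lipschitz. All control of `y ⬝ A y` passes through this root. -/
theorem HasLipschitzVariance.variance_sqrt_form_le (h : HasLipschitzVariance μ V) {z : ℝ}
    (hz : 0 < z) {A : Matrix (Fin p) (Fin p) ℝ} (hA : A.PosSemidef)
    (hAz : ∀ y : Fin p → ℝ, y ⬝ᵥ A *ᵥ y ≤ (y ⬝ᵥ y) / z) :
    Var[fun y => √(y.ofLp ⬝ᵥ A *ᵥ y.ofLp); μ] ≤ V / z := by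
  have hv := h.variance_le (fun y => √z * √(y.ofLp ⬝ᵥ A *ᵥ y.ofLp)) ?_ ?_
  · rw [variance_const_mul, Real.sq_sqrt hz.le] at hv
    rwa [le_div_iff₀' hz]
  · refine LipschitzWith.of_le_add_mul 1 fun x y => ?_
    have h1 := hA.sqrt_add_le y.ofLp (x.ofLp - y.ofLp)
    rw [add_sub_cancel] at h1
    have h2 : √((x.ofLp - y.ofLp) ⬝ᵥ A *ᵥ (x.ofLp - y.ofLp)) ≤ ‖x - y‖ / √z := by
      rw [Real.sqrt_le_left (by positivity), div_pow, Real.sq_sqrt hz.le, norm_sq_eq_dotProduct]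
      exact hAz _
    have h3 : √z * (‖x - y‖ / √z) = ‖x - y‖ := by
      have : √z ≠ 0 := (Real.sqrt_pos.2 hz).ne'
      field_simp
    have h4 := mul_le_mul_of_nonneg_left (h1.trans (add_le_add_right h2 _)) (Real.sqrt_nonneg z)
    rw [mul_add, h3] at h4
    simpa [dist_eq_norm] using h4
  · refine ⟨convex_univ, fun x _ y _ a b ha hb _ => ?_⟩
    have h1 := hA.sqrt_add_le (a • x.ofLp) (b • y.ofLp)
    have hs : ∀ (c : ℝ) (_ : 0 ≤ c) (w : Fin p → ℝ),
        √((c • w) ⬝ᵥ A *ᵥ (c • w)) = c * √(w ⬝ᵥ A *ᵥ w) := by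
      intro c hc w
      rw [mulVec_smul, dotProduct_smul, smul_dotProduct, smul_eq_mul, smul_eq_mul, ← mul_assoc,
        Real.sqrt_mul (by positivity), Real.sqrt_mul_self hc]
    rw [hs a ha, hs b hb] at h1
    have h4 := mul_le_mul_of_nonneg_left h1 (Real.sqrt_nonneg z)
    simp only [WithLp.ofLp_add, WithLp.ofLp_smul, smul_eq_mul]
    linarith

variable [IsProbabilityMeasure μ]

theorem integral_dotProduct (hμ : MemLp id 2 μ) (v : Fin p → ℝ) :
    ∫ y, v ⬝ᵥ y.ofLp ∂μ = v ⬝ᵥ meanVec μ := by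
  simp only [dotProduct, meanVec]
  rw [integral_finsetSum _ fun a _ => ((memLp_apply hμ a).integrable (by norm_num)).const_mul _]
  simp_rw [integral_const_mul]

theorem dotProduct_covMat_mulVec (hμ : MemLp id 2 μ) (v : Fin p → ℝ) :
    v ⬝ᵥ covMat μ *ᵥ v = Var[fun y => v ⬝ᵥ y.ofLp; μ] := by
  rw [variance_eq_sub (memLp_dotProduct hμ v), integral_dotProduct hμ, covMat, sub_mulVec,
    dotProduct_sub, dotProduct_popCov_mulVec hμ, vecMulVec_mulVec]
  simp [pow_two, dotProduct_comm]

theorem covMat_posSemidef (hμ : MemLp id 2 μ) : (covMat μ).PosSemidef := by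
  refine posSemidef_real_iff.2 ⟨?_, fun v => ?_⟩
  · rw [covMat, transpose_sub, (popCov_posSemidef hμ).symm_real, transpose_vecMulVec]
  · rw [dotProduct_covMat_mulVec hμ]; exact variance_nonneg _ _

/-- Linear functionals are convex and Lipschitz, so the centred covariance has norm at most `V`
whatever the dimension. -/
theorem HasLipschitzVariance.covMat_form_le (h : HasLipschitzVariance μ V) (v : Fin p → ℝ) :
    v ⬝ᵥ covMat μ *ᵥ v ≤ V * (v ⬝ᵥ v) := by
  rw [dotProduct_covMat_mulVec h.memLp_id]
  rcases (dotProduct_self_nonneg_real v).eq_or_lt with h0 | h0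
  · have : v = 0 := dotProduct_self_eq_zero.1 h0.symm
    simp only [this, zero_dotProduct, mul_zero]
    exact (variance_zero μ).le
  set c := √(v ⬝ᵥ v) with hc
  have hc0 : 0 < c := Real.sqrt_pos.2 h0
  have hv := h.variance_le (fun y => c⁻¹ * (v ⬝ᵥ y.ofLp)) ?_ ?_
  · rw [variance_const_mul, inv_pow, Real.sq_sqrt h0.le] at hv
    rwa [inv_mul_le_iff₀ h0, mul_comm] at hv
  · refine LipschitzWith.of_le_add_mul 1 fun x y => ?_
    have h1 := (le_abs_self _).trans (abs_dotProduct_le_sqrt v (x.ofLp - y.ofLp))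
    have h2 : √((x.ofLp - y.ofLp) ⬝ᵥ (x.ofLp - y.ofLp)) = ‖x - y‖ := by
      rw [← WithLp.ofLp_sub, ← norm_sq_eq_dotProduct, Real.sqrt_sq (norm_nonneg _)]
    rw [h2, ← hc, dotProduct_sub, ← inv_mul_le_iff₀ hc0, mul_sub] at h1
    rw [NNReal.coe_one, one_mul, dist_eq_norm]
    linarith
  · refine ⟨convex_univ, fun x _ y _ a b ha hb _ => le_of_eq ?_⟩
    simp only [WithLp.ofLp_add, WithLp.ofLp_smul, smul_eq_mul, dotProduct_add, dotProduct_smul]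
    ring

theorem HasLipschitzVariance.abs_dotProduct_covMat_le (h : HasLipschitzVariance μ V)
    (u v : Fin p → ℝ) : |u ⬝ᵥ covMat μ *ᵥ v| ≤ V * (√(u ⬝ᵥ u) * √(v ⬝ᵥ v)) := by
  refine ((covMat_posSemidef h.memLp_id).abs_dotProduct_mulVec_le u v).trans ?_
  have h1 := Real.sqrt_le_sqrt (h.covMat_form_le u)
  have h2 := Real.sqrt_le_sqrt (h.covMat_form_le v)
  rw [Real.sqrt_mul h.nonneg] at h1 h2
  refine (mul_le_mul h1 h2 (by positivity) (by positivity)).trans (le_of_eq ?_)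
  rw [mul_mul_mul_comm, Real.mul_self_sqrt h.nonneg]

theorem HasLipschitzVariance.variance_apply_le (h : HasLipschitzVariance μ V) (a : Fin p) :
    Var[fun y => y a; μ] ≤ V := by
  have := h.covMat_form_le (Pi.single a 1)
  rw [dotProduct_covMat_mulVec h.memLp_id] at this
  simpa using this

theorem meanVec_eq (hμ : MemLp id 2 μ) : meanVec μ = (∫ y, y ∂μ).ofLp := by
  ext a
  have := ContinuousLinearMap.integral_comp_comm (EuclideanSpace.proj (𝕜 := ℝ) a)
    (hμ.integrable (by norm_num))
  simpa [meanVec] using this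

/-- Each of the `p` coordinates has variance at most `V`, and the squared norm of the mean is at
most `B² p`. -/
theorem HasLipschitzVariance.integral_dotProduct_self_le (h : HasLipschitzVariance μ V) {B : ℝ}
    (hB : ‖∫ y, y ∂μ‖ ≤ B * √(p : ℝ)) :
    ∫ y, y.ofLp ⬝ᵥ y.ofLp ∂μ ≤ (V + B ^ 2) * p := by
  have h1 : ∫ y, y.ofLp ⬝ᵥ y.ofLp ∂μ = ∑ a, (Var[fun y => y a; μ] + meanVec μ a ^ 2) := by
    simp only [dotProduct]
    rw [integral_finsetSum _ fun a _ => integrable_apply_mul_apply h.memLp_id a a]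
    refine Finset.sum_congr rfl fun a _ => ?_
    rw [variance_eq_sub (memLp_apply h.memLp_id a)]
    simp [meanVec, pow_two]
  have h2 : ∑ a, meanVec μ a ^ 2 ≤ B ^ 2 * p := by
    have e : ∑ a, meanVec μ a ^ 2 = ‖∫ y, y ∂μ‖ ^ 2 := by
      rw [EuclideanSpace.real_norm_sq_eq, meanVec_eq h.memLp_id]
    rw [e]
    refine (pow_le_pow_left₀ (norm_nonneg _) hB 2).trans (le_of_eq ?_)
    rw [mul_pow, Real.sq_sqrt (Nat.cast_nonneg p)]
  rw [h1, Finset.sum_add_distrib, add_mul]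
  refine add_le_add ((Finset.sum_le_sum fun a _ => h.variance_apply_le a).trans ?_) h2
  simp [mul_comm]

end Law

/-! ### The fixed-point system: existence, uniqueness, stability. -/

section FixedPoint

variable {p n k : ℕ} {μ : Fin k → Measure (EuclideanSpace ℝ (Fin p))} {cls : Fin n → Fin k}
  {z : ℝ} {d d' : Fin k → ℝ}

theorem sigmaOf_form (v : Fin p → ℝ) :
    v ⬝ᵥ sigmaOf μ cls d *ᵥ v =
      ∑ l, (classSize cls l : ℝ) / (n : ℝ) / (1 + d l) * (v ⬝ᵥ popCov (μ l) *ᵥ v) := by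
  simp [sigmaOf, sum_mulVec, dotProduct_sum, smul_mulVec]

theorem sigmaOf_posSemidef (hμ : ∀ l, MemLp id 2 (μ l)) (hd : ∀ l, 0 ≤ d l) :
    (sigmaOf μ cls d).PosSemidef := by
  refine posSemidef_sum _ fun l _ => (popCov_posSemidef (hμ l)).smul ?_
  have := hd l
  positivity

theorem isResolventBound_tildeQ (hμ : ∀ l, MemLp id 2 (μ l)) (hd : ∀ l, 0 ≤ d l) (hz : 0 < z) :
    IsResolventBound z (tildeQ μ cls z d) :=
  isResolventBound_resolventMat (sigmaOf_posSemidef hμ hd) hz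

/-- The hypothesis gives `Σ_{d'} ≤ α Σ_d`; since `α ≥ 1` the term `z` obeys the same inequality, and
inversion reverses the order. -/
theorem tildeQ_form_le (hμ : ∀ l, MemLp id 2 (μ l)) (hd : ∀ l, 0 ≤ d l) (hd' : ∀ l, 0 ≤ d' l)
    (hz : 0 < z) {α : ℝ} (hα : 1 ≤ α) (h : ∀ l, 1 + d l ≤ α * (1 + d' l)) (y : Fin p → ℝ) :
    y ⬝ᵥ tildeQ μ cls z d *ᵥ y ≤ α * (y ⬝ᵥ tildeQ μ cls z d' *ᵥ y) := by
  refine resolventMat_form_le (sigmaOf_posSemidef hμ hd) (sigmaOf_posSemidef hμ hd') hz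
    (by linarith) (fun v => ?_) y
  have h1 : v ⬝ᵥ sigmaOf μ cls d' *ᵥ v ≤ α * (v ⬝ᵥ sigmaOf μ cls d *ᵥ v) := by
    rw [sigmaOf_form, sigmaOf_form, Finset.mul_sum]
    refine Finset.sum_le_sum fun l _ => ?_
    rw [← mul_assoc]
    refine mul_le_mul_of_nonneg_right ?_ ((popCov_posSemidef (hμ l)).nonneg_real v)
    have h1 := hd l
    have h2 := hd' l
    have h3 : (0 : ℝ) ≤ (classSize cls l : ℝ) / n := by positivity
    rw [← mul_div_assoc, div_le_div_iff₀ (by linarith) (by linarith)]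
    nlinarith [h l]
  have h2 := mul_le_mul_of_nonneg_right hα (mul_nonneg hz.le (dotProduct_self_nonneg_real v))
  linarith

theorem classSize_form_le (hμ : ∀ l, MemLp id 2 (μ l)) (hd : ∀ l, 0 ≤ d l) (l : Fin k)
    (v : Fin p → ℝ) :
    (classSize cls l : ℝ) / (n : ℝ) / (1 + d l) * (v ⬝ᵥ popCov (μ l) *ᵥ v) ≤
      v ⬝ᵥ sigmaOf μ cls d *ᵥ v := by
  rw [sigmaOf_form]
  refine Finset.single_le_sum (f := fun l => (classSize cls l : ℝ) / (n : ℝ) / (1 + d l) *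
    (v ⬝ᵥ popCov (μ l) *ᵥ v)) (fun l _ => ?_) (Finset.mem_univ l)
  have h1 := hd l
  have := (popCov_posSemidef (hμ l)).nonneg_real v
  positivity

/-- The map `d ↦ ((1/n) tr (Σ_l Q̃_d))_l` whose fixed point is `δ'`. -/
noncomputable def deltaMap (μ : Fin k → Measure (EuclideanSpace ℝ (Fin p))) (cls : Fin n → Fin k)
    (z : ℝ) (d : Fin k → ℝ) : Fin k → ℝ :=
  fun l => (1 / (n : ℝ)) * Matrix.trace (popCov (μ l) * tildeQ μ cls z d)

theorem deltaMap_eq_integral (hμ : ∀ l, MemLp id 2 (μ l)) (l : Fin k) :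
    deltaMap μ cls z d l =
      (1 / (n : ℝ)) * ∫ y, y.ofLp ⬝ᵥ tildeQ μ cls z d *ᵥ y.ofLp ∂(μ l) := by
  rw [deltaMap, trace_popCov_mul (hμ l)]

theorem deltaMap_nonneg (hμ : ∀ l, MemLp id 2 (μ l)) (hd : ∀ l, 0 ≤ d l) (hz : 0 < z)
    (l : Fin k) : 0 ≤ deltaMap μ cls z d l := by
  rw [deltaMap_eq_integral hμ]
  exact mul_nonneg (by positivity) (integral_nonneg fun y =>
    ((isResolventBound_tildeQ (cls := cls) hμ hd hz).posSemidef hz).nonneg_real y.ofLp)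

/-- The gain over a Lipschitz estimate is structural: the hypothesis bounds `1 + d`, the conclusion
bounds `Ψ(d)` without the `1`. This missing `1` is what makes the system stable. -/
theorem deltaMap_le_mul (hμ : ∀ l, MemLp id 2 (μ l)) (hd : ∀ l, 0 ≤ d l) (hd' : ∀ l, 0 ≤ d' l)
    (hz : 0 < z) {α : ℝ} (hα : 1 ≤ α) (h : ∀ l, 1 + d l ≤ α * (1 + d' l)) (l : Fin k) :
    deltaMap μ cls z d l ≤ α * deltaMap μ cls z d' l := by
  rw [deltaMap_eq_integral hμ, deltaMap_eq_integral hμ, mul_left_comm,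
    ← integral_const_mul α]
  refine mul_le_mul_of_nonneg_left ?_ (by positivity)
  exact integral_mono (integrable_form (hμ l) _) ((integrable_form (hμ l) _).const_mul _)
    fun y => tildeQ_form_le hμ hd hd' hz hα h y.ofLp

theorem integral_form_le (hμ : ∀ l, MemLp id 2 (μ l)) (hz : 0 < z)
    {A : Matrix (Fin p) (Fin p) ℝ} (hA : IsResolventBound z A) {T : ℝ} {l : Fin k}
    (hT : ∫ y, y.ofLp ⬝ᵥ y.ofLp ∂(μ l) ≤ T) :
    ∫ y, y.ofLp ⬝ᵥ A *ᵥ y.ofLp ∂(μ l) ≤ T / z := by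
  have h1 : Integrable (fun y : EuclideanSpace ℝ (Fin p) => y.ofLp ⬝ᵥ y.ofLp) (μ l) := by
    simpa using integrable_form (hμ l) 1
  refine (integral_mono (integrable_form (hμ l) _) (h1.div_const z)
    fun y => hA.form_le hz y.ofLp).trans ?_
  rw [integral_div]
  exact div_le_div_of_nonneg_right hT hz.le

theorem deltaMap_le (hμ : ∀ l, MemLp id 2 (μ l)) (hd : ∀ l, 0 ≤ d l) (hz : 0 < z) (hn : 0 < n)
    {T : ℝ} (l : Fin k) (hT : ∫ y, y.ofLp ⬝ᵥ y.ofLp ∂(μ l) ≤ T * n) :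
    deltaMap μ cls z d l ≤ T / z := by
  rw [deltaMap_eq_integral hμ]
  have h := integral_form_le hμ hz (isResolventBound_tildeQ (cls := cls) hμ hd hz) hT
  have hn' : (0 : ℝ) < n := by exact_mod_cast hn
  refine (mul_le_mul_of_nonneg_left h (by positivity)).trans (le_of_eq ?_)
  field_simp

theorem isDeltaPrime_iff :
    IsDeltaPrime μ cls z d ↔ (∀ l, 0 ≤ d l) ∧ ∀ l, d l = deltaMap μ cls z d l := Iff.rfl

theorem exists_isDeltaPrime (hμ : ∀ l, MemLp id 2 (μ l)) (hz : 0 < z) (hn : 0 < n)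
    {T : ℝ} (hT0 : 0 ≤ T) (hT : ∀ l, ∫ y, y.ofLp ⬝ᵥ y.ofLp ∂(μ l) ≤ T * n) :
    ∃ d, IsDeltaPrime μ cls z d := by
  have h0 : (0 : Fin k → ℝ) ≤ fun _ => T / z := fun _ => div_nonneg hT0 hz.le
  have : Fact ((0 : Fin k → ℝ) ≤ fun _ => T / z) := ⟨h0⟩
  -- Knaster–Tarski on the complete lattice `[0, T/z]ᵏ`: `Ψ` preserves it and, by the case `α = 1`,
  -- is monotone.
  let f : Set.Icc (0 : Fin k → ℝ) (fun _ => T / z) →o Set.Icc (0 : Fin k → ℝ) (fun _ => T / z) :=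
    { toFun := fun d => ⟨deltaMap μ cls z d.1, fun l => deltaMap_nonneg hμ d.2.1 hz l,
        fun l => deltaMap_le hμ d.2.1 hz hn l (hT l)⟩
      monotone' := fun d d' h l => by
        have := deltaMap_le_mul (cls := cls) hμ d.2.1 d'.2.1 hz le_rfl
          (fun l => by rw [one_mul]; exact add_le_add_right (h l) 1) l
        simpa using this }
  have hf := congrArg Subtype.val f.isFixedPt_lfp
  exact ⟨f.lfp.1, isDeltaPrime_iff.2 ⟨f.lfp.2.1, fun l => (congrFun hf l).symm⟩⟩

/-- Stability: an approximate solution of the system is close to any solution. -/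
theorem one_add_le_of_approx (hμ : ∀ l, MemLp id 2 (μ l)) (hz : 0 < z) (hd : ∀ l, 0 ≤ d l)
    (hd' : IsDeltaPrime μ cls z d') {ε : ℝ} (hε0 : 0 ≤ ε) (hε : ε ≤ 1 / 2)
    (h : ∀ l, |d l - deltaMap μ cls z d l| ≤ ε) (l : Fin k) :
    1 + d l ≤ (1 + 2 * ε) * (1 + d' l) ∧ 1 + d' l ≤ (1 + 2 * ε) * (1 + d l) := by
  obtain ⟨hd'0, hd'1⟩ := isDeltaPrime_iff.1 hd'
  have hu : ∀ l, 0 < 1 + d l := fun l => by linarith [hd l]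
  have hu' : ∀ l, 0 < 1 + d' l := fun l => by linarith [hd'0 l]
  have : Nonempty (Fin k) := ⟨l⟩
  -- `α` is the largest ratio between `1 + d` and `1 + d'`, in either direction, and `m` is a
  -- coordinate attaining it.
  obtain ⟨m, hm⟩ := Finite.exists_max
    (fun l => max ((1 + d l) / (1 + d' l)) ((1 + d' l) / (1 + d l)))
  set α := max ((1 + d m) / (1 + d' m)) ((1 + d' m) / (1 + d m)) with hα
  have h1 : ∀ l, 1 + d l ≤ α * (1 + d' l) := fun l =>
    (div_le_iff₀ (hu' l)).1 ((le_max_left _ _).trans (hm l))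
  have h2 : ∀ l, 1 + d' l ≤ α * (1 + d l) := fun l =>
    (div_le_iff₀ (hu l)).1 ((le_max_right _ _).trans (hm l))
  have hα1 : 1 ≤ α := by
    by_contra! hc
    nlinarith [h1 m, h2 m, hu m, hu' m]
  have hb := abs_le.1 (h m)
  have key : α ≤ 1 + 2 * ε := by
    rcases max_choice ((1 + d m) / (1 + d' m)) ((1 + d' m) / (1 + d m)) with hc | hc
    -- `α (1 + d'_m) = 1 + d_m ≤ 1 + ε + Ψ(d)_m ≤ 1 + ε + α d'_m`, so even `α ≤ 1 + ε`.
    · rw [← hα, eq_div_iff (hu' m).ne'] at hc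
      have := deltaMap_le_mul (cls := cls) hμ hd hd'0 hz hα1 h1 m
      rw [← hd'1 m] at this
      nlinarith
    -- `α (1 + d_m) = 1 + Ψ(d')_m ≤ 1 + α Ψ(d)_m ≤ 1 + α (d_m + ε)`, so `α (1 - ε) ≤ 1`; this is
    -- where `ε ≤ 1/2` gives `α ≤ 1 + 2ε`.
    · rw [← hα, eq_div_iff (hu m).ne'] at hc
      have := deltaMap_le_mul (cls := cls) hμ hd'0 hd hz hα1 h2 m
      rw [← hd'1 m] at this
      nlinarith
  exact ⟨(h1 l).trans (mul_le_mul_of_nonneg_right key (hu' l).le),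
    (h2 l).trans (mul_le_mul_of_nonneg_right key (hu l).le)⟩

theorem isDeltaPrime_unique (hμ : ∀ l, MemLp id 2 (μ l)) (hz : 0 < z)
    (hd : IsDeltaPrime μ cls z d) (hd' : IsDeltaPrime μ cls z d') : d = d' := by
  ext l
  have := one_add_le_of_approx hμ hz hd.1 hd' (ε := 0) le_rfl (by norm_num)
    (fun l => by rw [← (isDeltaPrime_iff.1 hd).2 l]; simp) l
  linarith

theorem spectralNorm₂_le_of_form {T : Matrix (Fin p) (Fin p) ℝ} (hT : Tᵀ = T) {ε : ℝ}
    (hε : 0 < ε) (h : ∀ y : Fin p → ℝ, |y ⬝ᵥ T *ᵥ y| ≤ ε * (y ⬝ᵥ y)) : spectralNorm₂ T ≤ ε := by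
  refine ContinuousLinearMap.opNorm_le_bound _ hε.le fun x => ?_
  set y := x.ofLp
  have e : (Matrix.toEuclideanCLM (n := Fin p) (𝕜 := ℝ) T x).ofLp = T *ᵥ y := by
    simp [y]
  refine le_of_sq_le_sq ?_ (by positivity)
  rw [mul_pow, norm_sq_eq_dotProduct, norm_sq_eq_dotProduct, e]
  -- Polarization: the forms at `ε⁻¹ T y ± y` differ by `4 ε⁻¹ |T y|²`, and the parallelogram law
  -- bounds the sum of the two right-hand sides.
  have h1 := (abs_le.1 (h (ε⁻¹ • (T *ᵥ y) + y))).2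
  have h2 := (abs_le.1 (h (ε⁻¹ • (T *ᵥ y) - y))).1
  have hs : (T *ᵥ y) ⬝ᵥ T *ᵥ y = y ⬝ᵥ T *ᵥ (T *ᵥ y) := mulVec_dotProduct_of_symm hT _ _
  simp only [mulVec_add, mulVec_sub, mulVec_smul, dotProduct_add, add_dotProduct, dotProduct_sub,
    sub_dotProduct, dotProduct_smul, smul_dotProduct, smul_eq_mul, ← hs,
    dotProduct_comm y (T *ᵥ y)] at h1 h2
  set a := (T *ᵥ y) ⬝ᵥ T *ᵥ y
  have h3 : 4 * (ε⁻¹ * a) ≤ ε * (2 * (ε⁻¹ * (ε⁻¹ * a)) + 2 * (y ⬝ᵥ y)) := by linarith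
  have h4 : ε * (2 * (ε⁻¹ * (ε⁻¹ * a)) + 2 * (y ⬝ᵥ y)) = 2 * (ε⁻¹ * a) + 2 * ε * (y ⬝ᵥ y) := by
    field_simp
  rw [h4] at h3
  have h5 : ε⁻¹ * a ≤ ε * (y ⬝ᵥ y) := by linarith
  rw [inv_mul_le_iff₀ hε] at h5
  linarith

/-- The multiplicative comparison in both directions bounds the difference of the two forms by `ε`
times one of them, and each is at most `|y|² / z`. -/
theorem spectralNorm₂_tildeQ_sub_le (hμ : ∀ l, MemLp id 2 (μ l)) (hz : 0 < z)
    (hd : ∀ l, 0 ≤ d l) (hd' : ∀ l, 0 ≤ d' l) {ε : ℝ} (hε : 0 < ε)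
    (h : ∀ l, 1 + d l ≤ (1 + ε) * (1 + d' l) ∧ 1 + d' l ≤ (1 + ε) * (1 + d l)) :
    spectralNorm₂ (tildeQ μ cls z d - tildeQ μ cls z d') ≤ ε / z := by
  have hA := isResolventBound_tildeQ (cls := cls) hμ hd hz
  have hA' := isResolventBound_tildeQ (cls := cls) hμ hd' hz
  refine spectralNorm₂_le_of_form (by rw [transpose_sub, hA.symm, hA'.symm])
    (by positivity) fun y => ?_
  have h1 := tildeQ_form_le (cls := cls) hμ hd hd' hz (by linarith : 1 ≤ 1 + ε)
    (fun l => (h l).1) y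
  have h2 := tildeQ_form_le (cls := cls) hμ hd' hd hz (by linarith : 1 ≤ 1 + ε)
    (fun l => (h l).2) y
  have h3 := mul_le_mul_of_nonneg_left (hA.form_le hz y) hε.le
  have h4 := mul_le_mul_of_nonneg_left (hA'.form_le hz y) hε.le
  have e : ε / z * (y ⬝ᵥ y) = ε * ((y ⬝ᵥ y) / z) := by ring
  rw [sub_mulVec, dotProduct_sub, abs_le, e]
  constructor <;> linarith

end FixedPoint

/-! ### Estimates for one random column, the other columns being frozen. -/

section Conditional

/-- Centring at the quadratic mean `√F` instead of the mean `m ≤ √F` costs a factor `2`: the left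
side is `2√F (√F - m)`, the variance is `(√F + m)(√F - m)`. -/
theorem integral_sub_sqrt_sq_le {Ω : Type*} [MeasurableSpace Ω] {P : Measure Ω}
    [IsProbabilityMeasure P] {s : Ω → ℝ} (hs0 : ∀ ω, 0 ≤ s ω) (hs : MemLp s 2 P) :
    ∫ ω, (s ω - √(∫ ω, s ω ^ 2 ∂P)) ^ 2 ∂P ≤ 2 * Var[s; P] := by
  set F := ∫ ω, s ω ^ 2 ∂P with hF
  have hF0 : 0 ≤ F := integral_nonneg fun ω => sq_nonneg _
  have hv : Var[s; P] = F - (∫ ω, s ω ∂P) ^ 2 := by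
    rw [variance_eq_sub hs]; rfl
  have hm : 0 ≤ ∫ ω, s ω ∂P := integral_nonneg hs0
  have hle : ∫ ω, s ω ∂P ≤ √F := by
    apply Real.le_sqrt_of_sq_le
    linarith [variance_nonneg s P]
  have e : ∫ ω, (s ω - √F) ^ 2 ∂P = 2 * F - 2 * √F * ∫ ω, s ω ∂P := by
    have e1 : ∀ ω, (s ω - √F) ^ 2 = s ω ^ 2 - 2 * √F * s ω + F := by
      intro ω
      have := Real.sq_sqrt hF0
      linear_combination this
    simp_rw [e1]
    have i1 := hs.integrable_sq
    have i2 := (hs.integrable (by norm_num)).const_mul (2 * √F)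
    have i3 : Integrable (fun ω => s ω ^ 2 - 2 * √F * s ω) P := i1.sub i2
    rw [integral_add i3 (integrable_const _), integral_sub i1 i2, integral_const_mul]
    simp
    ring
  rw [e, hv]
  nlinarith [Real.sq_sqrt hF0]

/-- The extra factor `s` is bounded by the denominators, since `s (s + f) ≤ 2 (1 + f²)(1 + s²)`. The
comparison is thereby made at the level of square roots, where concentration is available. -/
theorem mul_abs_inv_sub_inv_le {s f : ℝ} (hs : 0 ≤ s) (hf : 0 ≤ f) :
    s * |1 / (1 + f ^ 2) - 1 / (1 + s ^ 2)| ≤ 2 * |s - f| := by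
  have e : 1 / (1 + f ^ 2) - 1 / (1 + s ^ 2) =
      (s - f) * ((s + f) / ((1 + f ^ 2) * (1 + s ^ 2))) := by
    field_simp
    ring
  rw [e, abs_mul, abs_of_nonneg (a := (s + f) / _) (by positivity)]
  have h1 : s * ((s + f) / ((1 + f ^ 2) * (1 + s ^ 2))) ≤ 2 := by
    rw [← mul_div_assoc, div_le_iff₀ (by positivity)]
    nlinarith [sq_nonneg (s - f), mul_nonneg (sq_nonneg s) (sq_nonneg f)]
  nlinarith [abs_nonneg (s - f)]

theorem abs_inv_one_add_sub_le {a b : ℝ} (ha : 0 ≤ a) (hb : 0 ≤ b) :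
    |1 / (1 + a) - 1 / (1 + b)| ≤ |a - b| := by
  have e : 1 / (1 + a) - 1 / (1 + b) = (b - a) / ((1 + a) * (1 + b)) := by
    field_simp
    ring
  rw [e, abs_div, abs_sub_comm b a, abs_of_pos (a := (1 + a) * (1 + b)) (by positivity)]
  exact div_le_self (abs_nonneg _) (by nlinarith)

variable {p : ℕ} {μ : Measure (EuclideanSpace ℝ (Fin p))} {V T n z w δ : ℝ}
  {A R C : Matrix (Fin p) (Fin p) ℝ}

theorem continuous_form (N : Matrix (Fin p) (Fin p) ℝ) :
    Continuous fun y : EuclideanSpace ℝ (Fin p) => y.ofLp ⬝ᵥ N *ᵥ y.ofLp := by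
  have h : Continuous fun y : EuclideanSpace ℝ (Fin p) => y.ofLp :=
    PiLp.continuous_ofLp 2 _
  exact h.dotProduct (continuous_const.matrix_mulVec h)

theorem integrable_form_div (hμ : MemLp id 2 μ) (N : Matrix (Fin p) (Fin p) ℝ)
    {r : EuclideanSpace ℝ (Fin p) → ℝ} (hr : Measurable r) (hr1 : ∀ y, |r y| ≤ 1) :
    Integrable (fun y : EuclideanSpace ℝ (Fin p) => r y * (y.ofLp ⬝ᵥ N *ᵥ y.ofLp)) μ :=
  (integrable_form hμ N).bdd_mul hr.aestronglyMeasurable (c := 1)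
    (Filter.Eventually.of_forall hr1)

theorem integrable_dotProduct_self (hμ : MemLp id 2 μ) :
    Integrable (fun y : EuclideanSpace ℝ (Fin p) => y.ofLp ⬝ᵥ y.ofLp) μ := by
  simpa using integrable_form hμ 1

theorem popCov_form_le (hμ : MemLp id 2 μ) (hT : ∫ y, y.ofLp ⬝ᵥ y.ofLp ∂μ ≤ T)
    (u : Fin p → ℝ) : u ⬝ᵥ popCov μ *ᵥ u ≤ T * (u ⬝ᵥ u) := by
  rw [dotProduct_popCov_mulVec hμ, mul_comm]
  refine le_trans ?_ (mul_le_mul_of_nonneg_left hT (dotProduct_self_nonneg_real u))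
  rw [← integral_const_mul]
  refine integral_mono ((memLp_dotProduct hμ u).integrable_mul (memLp_dotProduct hμ u))
    ((integrable_dotProduct_self hμ).const_mul _) fun y => ?_
  have := (PosSemidef.one (n := Fin p) (R := ℝ)).sq_dotProduct_mulVec_le u y.ofLp
  simpa [pow_two] using this

/-- `C` has norm at most `V`, stated on bilinear forms. -/
def FormBound (C : Matrix (Fin p) (Fin p) ℝ) (V : ℝ) : Prop :=
  ∀ u v : Fin p → ℝ, |u ⬝ᵥ C *ᵥ v| ≤ V * (√(u ⬝ᵥ u) * √(v ⬝ᵥ v))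

theorem FormBound.mulVec_self_le (hC : FormBound C V) (hV : 0 ≤ V) (u : Fin p → ℝ) :
    (C *ᵥ u) ⬝ᵥ (C *ᵥ u) ≤ V ^ 2 * (u ⬝ᵥ u) := by
  have h := (le_abs_self _).trans (hC (C *ᵥ u) u)
  have h1 := Real.sq_sqrt (dotProduct_self_nonneg_real (C *ᵥ u))
  have h2 := Real.sq_sqrt (dotProduct_self_nonneg_real u)
  set a := √((C *ᵥ u) ⬝ᵥ (C *ᵥ u)) with ha
  set b := √(u ⬝ᵥ u) with hb
  have ha0 : 0 ≤ a := Real.sqrt_nonneg _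
  have hb0 : 0 ≤ b := Real.sqrt_nonneg _
  rw [← h1] at h ⊢
  rw [← h2]
  have h3 : a ≤ V * b := by
    rcases ha0.eq_or_lt with h0 | h0
    · rw [← h0]; positivity
    · refine le_of_mul_le_mul_right ?_ h0
      nlinarith
  nlinarith [mul_nonneg hV hb0]

/-- `Σ` alone is bounded only by its trace `T`, but `R` is small where `Σ` is large: `hRw` says
`w/(1+δ) R Σ R ≤ R ≤ 1/z`. Cauchy–Schwarz for `Σ` uses the crude bound on one side and this one on
the other, hence only `√T`. -/
theorem abs_cross_form_div_le (hμ : MemLp id 2 μ) (hT : ∫ y, y.ofLp ⬝ᵥ y.ofLp ∂μ ≤ T)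
    (hT0 : 0 ≤ T) (hV : 0 ≤ V) (hz : 0 < z) (hw : 0 < w) (hδ : 0 ≤ δ) (hC : FormBound C V)
    (hR : IsResolventBound z R)
    (hRw : ∀ u : Fin p → ℝ, w / (1 + δ) * ((R *ᵥ u) ⬝ᵥ popCov μ *ᵥ (R *ᵥ u)) ≤ u ⬝ᵥ R *ᵥ u)
    (u : Fin p → ℝ) :
    |u ⬝ᵥ popCov μ *ᵥ (R *ᵥ (C *ᵥ u))| / (1 + δ) ≤ V * √(T / (z * w)) * (u ⬝ᵥ u) := by
  have hu := dotProduct_self_nonneg_real u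
  refine abs_le_of_sq_le_sq' ?_ (by positivity) |>.2
  have h1 := (popCov_posSemidef hμ).sq_dotProduct_mulVec_le u (R *ᵥ (C *ᵥ u))
  have h2 := popCov_form_le hμ hT u
  have h3 := hRw (C *ᵥ u)
  have h4 := hR.form_le hz (C *ᵥ u)
  have h5 := hC.mulVec_self_le hV u
  have h6 : (R *ᵥ (C *ᵥ u)) ⬝ᵥ popCov μ *ᵥ (R *ᵥ (C *ᵥ u)) ≤
      (1 + δ) / (z * w) * (V ^ 2 * (u ⬝ᵥ u)) := by
    have h7 := h3.trans (h4.trans (div_le_div_of_nonneg_right h5 hz.le))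
    rw [div_mul_eq_mul_div, div_le_div_iff₀ (by linarith) hz] at h7
    rw [div_mul_eq_mul_div, le_div_iff₀ (by positivity)]
    linarith
  have h8 := h1.trans (mul_le_mul h2 h6 ((popCov_posSemidef hμ).nonneg_real _) (by positivity))
  rw [div_pow, sq_abs, div_le_iff₀ (by positivity), mul_pow, mul_pow, Real.sq_sqrt (by positivity)]
  refine h8.trans ?_
  have e : T * (u ⬝ᵥ u) * ((1 + δ) / (z * w) * (V ^ 2 * (u ⬝ᵥ u))) =
    V ^ 2 * (T / (z * w)) * (u ⬝ᵥ u) ^ 2 * (1 + δ) := by ring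
  rw [e]
  refine mul_le_mul_of_nonneg_left ?_ (by positivity)
  nlinarith

variable [IsProbabilityMeasure μ]

/-- Concentration of `y ⬝ A y / n` around its mean, in the weighted form that is needed. -/
theorem integral_abs_form_mul_inv_sub_le (h : HasLipschitzVariance μ V) (hn : 0 < n) (hz : 0 < z)
    (hT : ∫ y, y.ofLp ⬝ᵥ y.ofLp ∂μ ≤ T * n)
    (hA : IsResolventBound z A) (hR : IsResolventBound z R) (hC : FormBound C V) :
    ∫ y, |(y.ofLp ⬝ᵥ (R * C * A) *ᵥ y.ofLp) *
        (1 / (1 + 1 / n * ∫ y, y.ofLp ⬝ᵥ A *ᵥ y.ofLp ∂μ) -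
          1 / (1 + 1 / n * (y.ofLp ⬝ᵥ A *ᵥ y.ofLp)))| ∂μ ≤
      V * √n / (z * √z) * (T + 2 * V / z) := by
  have hV := h.nonneg
  have hAp := hA.posSemidef hz
  have hA'p : ((1 / n) • A).PosSemidef := hAp.smul (by positivity)
  -- `s² = y ⬝ A y / n`, and `s` has variance at most `V / (n z)`.
  set s : EuclideanSpace ℝ (Fin p) → ℝ := fun y => √(y.ofLp ⬝ᵥ ((1 / n) • A) *ᵥ y.ofLp) with hs
  have hs0 : ∀ y, 0 ≤ s y := fun y => Real.sqrt_nonneg _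
  have hs2 : ∀ y, s y ^ 2 = 1 / n * (y.ofLp ⬝ᵥ A *ᵥ y.ofLp) := by
    intro y
    rw [hs, Real.sq_sqrt (hA'p.nonneg_real _)]
    simp [smul_mulVec]
  have hsm : Continuous s := (continuous_form _).sqrt
  have hsL : MemLp s 2 μ := by
    rw [memLp_two_iff_integrable_sq hsm.aestronglyMeasurable]
    simp_rw [hs2]
    exact (integrable_form h.memLp_id A).const_mul _
  set F := 1 / n * ∫ y, y.ofLp ⬝ᵥ A *ᵥ y.ofLp ∂μ with hF
  have hFs : ∫ y, s y ^ 2 ∂μ = F := by simp_rw [hs2]; rw [integral_const_mul]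
  have hF0 : 0 ≤ F := by rw [← hFs]; exact integral_nonneg fun y => sq_nonneg _
  have hvar : ∫ y, (s y - √F) ^ 2 ∂μ ≤ 2 * (V / (n * z)) := by
    have h1 := integral_sub_sqrt_sq_le hs0 hsL
    rw [hFs] at h1
    refine h1.trans (mul_le_mul_of_nonneg_left ?_ zero_le_two)
    refine h.variance_sqrt_form_le (by positivity) hA'p fun y => ?_
    rw [smul_mulVec, dotProduct_smul, smul_eq_mul]
    have := mul_le_mul_of_nonneg_left (hA.form_le hz y) (one_div_nonneg.2 hn.le)
    refine this.trans (le_of_eq ?_)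
    field_simp
  have hsI : Integrable (fun y => (s y - √F) ^ 2) μ := (hsL.sub (memLp_const _)).integrable_sq
  have hyI := integrable_dotProduct_self h.memLp_id
  have hpt : ∀ y : EuclideanSpace ℝ (Fin p), |(y.ofLp ⬝ᵥ (R * C * A) *ᵥ y.ofLp) *
      (1 / (1 + F) - 1 / (1 + 1 / n * (y.ofLp ⬝ᵥ A *ᵥ y.ofLp)))| ≤
      V * √n / (z * √z) * ((y.ofLp ⬝ᵥ y.ofLp) / n + n * (s y - √F) ^ 2) := by
    intro y
    rw [← hs2, abs_mul]
    have e1 : y.ofLp ⬝ᵥ (R * C * A) *ᵥ y.ofLp = (R *ᵥ y.ofLp) ⬝ᵥ C *ᵥ (A *ᵥ y.ofLp) := by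
      rw [mulVec_dotProduct_of_symm hR.symm, mulVec_mulVec, mulVec_mulVec]
    rw [e1]
    have h1 := hC (R *ᵥ y.ofLp) (A *ᵥ y.ofLp)
    have h2 : √((R *ᵥ y.ofLp) ⬝ᵥ (R *ᵥ y.ofLp)) ≤ √(y.ofLp ⬝ᵥ y.ofLp) / z := by
      have := Real.sqrt_le_sqrt (hR.mulVec_self_le_sq hz y.ofLp)
      rwa [Real.sqrt_div (dotProduct_self_nonneg_real _), Real.sqrt_sq hz.le] at this
    -- `|A y| ≤ √(n/z) s` supplies the factor `s` needed in `mul_abs_inv_sub_inv_le`; only second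
    -- moments of `y` are then required.
    have h3 : √((A *ᵥ y.ofLp) ⬝ᵥ (A *ᵥ y.ofLp)) ≤ √n / √z * s y := by
      have := Real.sqrt_le_sqrt (hA.mulVec_self_le hz y.ofLp)
      have e : y.ofLp ⬝ᵥ A *ᵥ y.ofLp = n * s y ^ 2 := by rw [hs2]; field_simp
      rw [e, Real.sqrt_div (by positivity), Real.sqrt_mul hn.le, Real.sqrt_sq (hs0 y)] at this
      refine this.trans (le_of_eq (by ring))
    have h4 := mul_abs_inv_sub_inv_le (hs0 y) (Real.sqrt_nonneg F)
    rw [Real.sq_sqrt hF0] at h4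
    set q := |1 / (1 + F) - 1 / (1 + s y ^ 2)|
    set a := √(y.ofLp ⬝ᵥ y.ofLp) with ha
    have haa : y.ofLp ⬝ᵥ y.ofLp = a ^ 2 := (Real.sq_sqrt (dotProduct_self_nonneg_real _)).symm
    rw [haa]
    have ha0 : 0 ≤ a := Real.sqrt_nonneg _
    have hq0 : 0 ≤ q := abs_nonneg _
    -- The weights `1/n` and `n` balance the scales: `|y|²` has mean `O(n)` and `(s - √F)²` has mean
    -- `O(1/n)`.
    have h5 : 2 * (a * |s y - √F|) ≤ a ^ 2 / n + n * (s y - √F) ^ 2 := by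
      rw [← sq_abs (s y - √F)]
      have hnn : √n ^ 2 = n := Real.sq_sqrt hn.le
      have hn0 : √n ≠ 0 := (Real.sqrt_pos.2 hn).ne'
      have := sq_nonneg (a / √n - √n * |s y - √F|)
      rw [sub_sq, div_pow, mul_pow, hnn] at this
      have e : 2 * (a / √n) * (√n * |s y - √F|) = 2 * (a * |s y - √F|) := by field_simp
      linarith
    calc |(R *ᵥ y.ofLp) ⬝ᵥ C *ᵥ (A *ᵥ y.ofLp)| * q
        ≤ V * (a / z * (√n / √z * s y)) * q := by
          refine mul_le_mul_of_nonneg_right (h1.trans ?_) hq0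
          refine mul_le_mul_of_nonneg_left ?_ hV
          exact mul_le_mul h2 h3 (Real.sqrt_nonneg _) (by positivity)
      _ = V * √n / (z * √z) * (a * (s y * q)) := by field_simp
      _ ≤ V * √n / (z * √z) * (a * (2 * |s y - √F|)) := by gcongr
      _ = V * √n / (z * √z) * (2 * (a * |s y - √F|)) := by ring
      _ ≤ _ := by gcongr
  refine (integral_mono_of_nonneg (Filter.Eventually.of_forall fun y => abs_nonneg _)
    (((hyI.div_const n).add (hsI.const_mul n)).const_mul _)
    (Filter.Eventually.of_forall hpt)).trans ?_
  rw [integral_const_mul]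
  refine mul_le_mul_of_nonneg_left ?_ (by positivity)
  rw [integral_add' (hyI.div_const n) (hsI.const_mul n), integral_div, integral_const_mul]
  have h1 := div_le_div_of_nonneg_right hT hn.le
  have h2 := mul_le_mul_of_nonneg_left hvar hn.le
  have e1 : T * n / n = T := by field_simp
  have e2 : n * (2 * (V / (n * z))) = 2 * V / z := by field_simp
  linarith

/-- Conditional estimate: `A` is the resolvent deprived of `y`, `R` its deterministic
approximation. -/
theorem abs_integral_bracket_le (h : HasLipschitzVariance μ V) (hn : 0 < n) (hz : 0 < z)
    (hT0 : 0 ≤ T) (hT : ∫ y, y.ofLp ⬝ᵥ y.ofLp ∂μ ≤ T * n) (hw : 0 < w) (hδ : 0 ≤ δ)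
    (hA : IsResolventBound z A) (hR : IsResolventBound z R) (hC : FormBound C V)
    (hRw : ∀ u : Fin p → ℝ, w / (1 + δ) * ((R *ᵥ u) ⬝ᵥ popCov μ *ᵥ (R *ᵥ u)) ≤ u ⬝ᵥ R *ᵥ u) :
    |∫ y, ((popCov μ * (R * C * A)).trace / (1 + δ) -
        1 / n * (1 / (1 + 1 / n * (y.ofLp ⬝ᵥ A *ᵥ y.ofLp))) *
          ((A *ᵥ y.ofLp) ⬝ᵥ popCov μ *ᵥ (R *ᵥ (C *ᵥ (A *ᵥ y.ofLp)))) / (1 + δ) -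
        1 / (1 + 1 / n * (y.ofLp ⬝ᵥ A *ᵥ y.ofLp)) * (y.ofLp ⬝ᵥ (R * C * A) *ᵥ y.ofLp)) ∂μ| ≤
      V * √(T * n / (z * w)) * T / z ^ 2 +
        V * T * n / z ^ 2 * |1 / n * ∫ y, y.ofLp ⬝ᵥ A *ᵥ y.ofLp ∂μ - δ| +
        V * √n / (z * √z) * (T + 2 * V / z) := by
  have hV := h.nonneg
  have hAp := hA.posSemidef hz
  set F := 1 / n * ∫ y, y.ofLp ⬝ᵥ A *ᵥ y.ofLp ∂μ with hF
  have hF0 : 0 ≤ F := mul_nonneg (by positivity) (integral_nonneg fun y => hAp.nonneg_real _)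
  set r : EuclideanSpace ℝ (Fin p) → ℝ := fun y => 1 / (1 + 1 / n * (y.ofLp ⬝ᵥ A *ᵥ y.ofLp)) with hr
  have hD0 : ∀ y : EuclideanSpace ℝ (Fin p), 0 ≤ 1 / n * (y.ofLp ⬝ᵥ A *ᵥ y.ofLp) := fun y =>
    mul_nonneg (by positivity) (hAp.nonneg_real _)
  have hr0 : ∀ y, 0 ≤ r y := fun y => by have := hD0 y; simp only [hr]; positivity
  have hr1' : ∀ y, r y ≤ 1 := fun y => by
    have := hD0 y
    simp only [hr]
    rw [div_le_one (by positivity)]; linarith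
  have hr1 : ∀ y, |r y| ≤ 1 := fun y => by rw [abs_of_nonneg (hr0 y)]; exact hr1' y
  have hrm : Measurable r :=
    (((continuous_form A).measurable.const_mul _).const_add _).const_div _
  set g : EuclideanSpace ℝ (Fin p) → ℝ := fun y => y.ofLp ⬝ᵥ (R * C * A) *ᵥ y.ofLp with hg
  set f : EuclideanSpace ℝ (Fin p) → ℝ :=
    fun y => (A *ᵥ y.ofLp) ⬝ᵥ popCov μ *ᵥ (R *ᵥ (C *ᵥ (A *ᵥ y.ofLp))) with hf
  have hf' : f = fun y => y.ofLp ⬝ᵥ (A * popCov μ * R * C * A) *ᵥ y.ofLp := by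
    ext y
    simp only [hf]
    rw [mulVec_dotProduct_of_symm hA.symm]
    simp only [mulVec_mulVec, Matrix.mul_assoc]
  have ig : Integrable g μ := integrable_form h.memLp_id _
  have irg : Integrable (fun y => r y * g y) μ := integrable_form_div h.memLp_id _ hrm hr1
  have irf : Integrable (fun y => r y * f y) μ := by
    rw [hf']; exact integrable_form_div h.memLp_id _ hrm hr1
  have hyI := integrable_dotProduct_self h.memLp_id
  have hG : (popCov μ * (R * C * A)).trace = ∫ y, g y ∂μ := trace_popCov_mul h.memLp_id _
  have i1 : Integrable (fun y => 1 / n * r y * f y / (1 + δ)) μ :=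
    ((irf.const_mul (1 / n)).div_const (1 + δ)).congr
      (Filter.Eventually.of_forall fun y => by simp only; ring)
  -- The mean of `g` being `tr(Σ R C A)`, inserting `1/(1+F)` between `1/(1+δ)` and `r` separates
  -- the rank-one correction (`b1`), the bias `F - δ` (`b2`) and the fluctuation around `F` (`b3`).
  have key : ∫ y, ((popCov μ * (R * C * A)).trace / (1 + δ) - 1 / n * r y * f y / (1 + δ) -
      r y * g y) ∂μ = -∫ y, 1 / n * r y * f y / (1 + δ) ∂μ +
        ∫ y, (1 / (1 + δ) - 1 / (1 + F)) * g y ∂μ + ∫ y, g y * (1 / (1 + F) - r y) ∂μ := by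
    have e3 : ∫ y, g y * (1 / (1 + F) - r y) ∂μ =
        1 / (1 + F) * ∫ y, g y ∂μ - ∫ y, r y * g y ∂μ := by
      rw [← integral_const_mul, ← integral_sub (ig.const_mul _) irg]
      congr with y; ring
    have i4 : Integrable (fun y => (popCov μ * (R * C * A)).trace / (1 + δ) -
      1 / n * r y * f y / (1 + δ)) μ := (integrable_const _).sub i1
    rw [integral_sub i4 irg, integral_sub (integrable_const _) i1, e3, integral_const_mul, hG]
    simp
    ring
  rw [key]
  have b1 : |∫ y, 1 / n * r y * f y / (1 + δ) ∂μ| ≤ V * √(T * n / (z * w)) * T / z ^ 2 := by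
    have hpt : ∀ y : EuclideanSpace ℝ (Fin p), ‖1 / n * r y * f y / (1 + δ)‖ ≤
        1 / n * (V * √(T * n / (z * w))) / z ^ 2 * (y.ofLp ⬝ᵥ y.ofLp) := by
      intro y
      have h1 := abs_cross_form_div_le h.memLp_id hT (by positivity) hV hz hw hδ hC hR hRw
        (A *ᵥ y.ofLp)
      have h2 := hA.mulVec_self_le_sq hz y.ofLp
      have hδ1 : 0 < 1 + δ := by linarith
      rw [Real.norm_eq_abs, abs_div, abs_mul, abs_mul, abs_of_pos hδ1,
        abs_of_pos (one_div_pos.2 hn), abs_of_nonneg (hr0 y)]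
      calc 1 / n * r y * |f y| / (1 + δ) ≤ 1 / n * 1 * |f y| / (1 + δ) := by
            gcongr; exact hr1' y
        _ = 1 / n * (|f y| / (1 + δ)) := by ring
        _ ≤ 1 / n * (V * √(T * n / (z * w)) * ((y.ofLp ⬝ᵥ y.ofLp) / z ^ 2)) := by
            refine mul_le_mul_of_nonneg_left (h1.trans ?_) (by positivity)
            exact mul_le_mul_of_nonneg_left h2 (by positivity)
        _ = _ := by ring
    refine (norm_integral_le_of_norm_le (hyI.const_mul _)
      (Filter.Eventually.of_forall hpt)).trans ?_
    rw [integral_const_mul]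
    refine (mul_le_mul_of_nonneg_left hT (by positivity)).trans (le_of_eq ?_)
    field_simp
  have b2 : |∫ y, (1 / (1 + δ) - 1 / (1 + F)) * g y ∂μ| ≤ V * T * n / z ^ 2 * |F - δ| := by
    rw [integral_const_mul, abs_mul]
    have h1 := abs_inv_one_add_sub_le hδ hF0
    have h2 : |∫ y, g y ∂μ| ≤ V * T * n / z ^ 2 := by
      have hpt : ∀ y : EuclideanSpace ℝ (Fin p), ‖g y‖ ≤ V / z ^ 2 * (y.ofLp ⬝ᵥ y.ofLp) := by
        intro y
        have e1 : g y = (R *ᵥ y.ofLp) ⬝ᵥ C *ᵥ (A *ᵥ y.ofLp) := by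
          rw [mulVec_dotProduct_of_symm hR.symm, mulVec_mulVec, mulVec_mulVec]
        have h2 : ∀ M, IsResolventBound z M →
            √((M *ᵥ y.ofLp) ⬝ᵥ (M *ᵥ y.ofLp)) ≤ √(y.ofLp ⬝ᵥ y.ofLp) / z := by
          intro M hM
          have := Real.sqrt_le_sqrt (hM.mulVec_self_le_sq hz y.ofLp)
          rwa [Real.sqrt_div (dotProduct_self_nonneg_real _), Real.sqrt_sq hz.le] at this
        rw [e1, Real.norm_eq_abs]
        refine (hC _ _).trans ((mul_le_mul_of_nonneg_left (mul_le_mul (h2 R hR) (h2 A hA)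
          (Real.sqrt_nonneg _) (by positivity)) hV).trans (le_of_eq ?_))
        rw [div_mul_div_comm, Real.mul_self_sqrt (dotProduct_self_nonneg_real _)]
        ring
      refine (norm_integral_le_of_norm_le (hyI.const_mul _)
        (Filter.Eventually.of_forall hpt)).trans ?_
      rw [integral_const_mul]
      refine (mul_le_mul_of_nonneg_left hT (by positivity)).trans (le_of_eq ?_)
      ring
    rw [abs_sub_comm δ F] at h1
    rw [mul_comm]
    exact mul_le_mul h2 h1 (abs_nonneg _) (by positivity)
  have b3 : |∫ y, g y * (1 / (1 + F) - r y) ∂μ| ≤ V * √n / (z * √z) * (T + 2 * V / z) :=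
    (abs_integral_le_integral_abs).trans
      (integral_abs_form_mul_inv_sub_le h hn hz hT hA hR hC)
  refine (abs_add_le _ _).trans (add_le_add ((abs_add_le _ _).trans (add_le_add ?_ b2)) b3)
  rwa [abs_neg]

end Conditional

/-! ### Product measures: resampling one coordinate and bounded differences. -/

section ProductSpace

/-- Resampling one coordinate independently keeps the product law. This expresses conditioning on
the other coordinates without splitting the index set. -/
theorem measurePreserving_update {ι α : Type*} [Fintype ι] [DecidableEq ι] [MeasurableSpace α]
    (ν : ι → Measure α) [∀ i, IsProbabilityMeasure (ν i)] (i : ι) :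
    MeasurePreserving (fun w : (ι → α) × α => Function.update w.1 i w.2)
      ((Measure.pi ν).prod (ν i)) (Measure.pi ν) := by
  have hm : Measurable (fun w : (ι → α) × α => Function.update w.1 i w.2) := measurable_update'
  refine ⟨hm, ?_⟩
  refine (Measure.pi_eq fun s hs => ?_).symm
  rw [Measure.map_apply hm (MeasurableSet.univ_pi hs)]
  have e : (fun w : (ι → α) × α => Function.update w.1 i w.2) ⁻¹' (Set.univ.pi s) =
      (Set.univ.pi (Function.update s i Set.univ)) ×ˢ s i := by
    ext ⟨x, y⟩
    simp only [Set.mem_preimage, Set.mem_pi, Set.mem_univ, true_imp_iff, Set.mem_prod]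
    constructor
    · refine fun h => ⟨fun j => ?_, by simpa using h i⟩
      by_cases hj : j = i
      · subst hj; simp
      · simpa [hj] using h j
    · rintro ⟨h1, h2⟩ j
      by_cases hj : j = i
      · subst hj; simpa using h2
      · simpa [hj] using h1 j
  rw [e, Measure.prod_prod, Measure.pi_pi]
  rw [← Finset.mul_prod_erase _ _ (Finset.mem_univ i),
    ← Finset.mul_prod_erase _ _ (Finset.mem_univ i)]
  simp only [Function.update_self, measure_univ, one_mul]
  rw [mul_comm]
  congr 1
  refine Finset.prod_congr rfl fun j hj => ?_
  rw [Function.update_of_ne (Finset.ne_of_mem_erase hj)]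

theorem integral_pi_eq_integral_update {ι α : Type*} [Fintype ι] [DecidableEq ι]
    [MeasurableSpace α] (ν : ι → Measure α) [∀ i, IsProbabilityMeasure (ν i)] (i : ι)
    {f : (ι → α) → ℝ} (hf : Integrable f (Measure.pi ν)) :
    Integrable (fun x => ∫ y, f (Function.update x i y) ∂(ν i)) (Measure.pi ν) ∧
    ∫ x, f x ∂(Measure.pi ν) = ∫ x, ∫ y, f (Function.update x i y) ∂(ν i) ∂(Measure.pi ν) := by
  have hmp := measurePreserving_update ν i
  have hi : Integrable (fun w : (ι → α) × α => f (Function.update w.1 i w.2))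
      ((Measure.pi ν).prod (ν i)) := hmp.integrable_comp_of_integrable hf
  refine ⟨hi.integral_prod_left, ?_⟩
  rw [← integral_prod _ hi]
  conv_lhs => rw [← hmp.map_eq]
  rw [integral_map hmp.measurable.aemeasurable]
  rw [hmp.map_eq]; exact hf.aestronglyMeasurable

theorem integrable_of_bound {Ω : Type*} [MeasurableSpace Ω] {P : Measure Ω} [IsFiniteMeasure P]
    {f : Ω → ℝ} (hf : Measurable f) {B : ℝ} (hB : ∀ ω, |f ω| ≤ B) : Integrable f P :=
  Integrable.of_bound hf.aestronglyMeasurable B (Filter.Eventually.of_forall hB)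

theorem memLp_two_of_bound {Ω : Type*} [MeasurableSpace Ω] {P : Measure Ω} [IsFiniteMeasure P]
    {f : Ω → ℝ} (hf : Measurable f) {B : ℝ} (hB : ∀ ω, |f ω| ≤ B) : MemLp f 2 P :=
  MemLp.of_bound hf.aestronglyMeasurable B (Filter.Eventually.of_forall hB)

/-- Total variance: for fixed `y` the function of `x` stays within `c` of its mean, so the
conditional variance is at most `c²`. -/
theorem variance_prod_le {α β : Type*} [MeasurableSpace α] [MeasurableSpace β] (ν : Measure α)
    (ρ : Measure β) [IsProbabilityMeasure ν] [IsProbabilityMeasure ρ] {f : α × β → ℝ}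
    (hf : Measurable f) {B c : ℝ} (hB : ∀ w, |f w| ≤ B)
    (hc : ∀ x x' y, |f (x, y) - f (x', y)| ≤ c) :
    Var[f; ν.prod ρ] ≤ c ^ 2 + Var[fun y => ∫ x, f (x, y) ∂ν; ρ] := by
  set g : β → ℝ := fun y => ∫ x, f (x, y) ∂ν with hg
  have hfy : ∀ y, Measurable fun x => f (x, y) := fun y => hf.comp measurable_prodMk_right
  have iy : ∀ y, Integrable (fun x => f (x, y)) ν := fun y =>
    integrable_of_bound (hfy y) fun x => hB _
  have ly : ∀ y, MemLp (fun x => f (x, y)) 2 ν := fun y =>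
    memLp_two_of_bound (hfy y) fun x => hB _
  have hgm : Measurable g :=
    (hf.stronglyMeasurable.integral_prod_left' (μ := ν)).measurable
  have hgB : ∀ y, |g y| ≤ B := fun y => by
    refine (abs_integral_le_integral_abs).trans ?_
    refine (integral_mono (iy y).abs (integrable_const B) fun x => hB _).trans ?_
    simp
  have lf : MemLp f 2 (ν.prod ρ) := memLp_two_of_bound hf hB
  have lg : MemLp g 2 ρ := memLp_two_of_bound hgm hgB
  have hvy : ∀ y, ∫ x, f (x, y) ^ 2 ∂ν ≤ c ^ 2 + g y ^ 2 := by
    intro y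
    have h1 := variance_eq_sub (ly y)
    have h2 : Var[fun x => f (x, y); ν] ≤ c ^ 2 := by
      rw [variance_eq_integral (hfy y).aemeasurable]
      have hpt : ∀ x, (f (x, y) - ∫ x', f (x', y) ∂ν) ^ 2 ≤ c ^ 2 := by
        intro x
        rw [← sq_abs]
        refine pow_le_pow_left₀ (abs_nonneg _) ?_ 2
        have e : f (x, y) - ∫ x', f (x', y) ∂ν = ∫ x', (f (x, y) - f (x', y)) ∂ν := by
          rw [integral_sub (integrable_const _) (iy y)]; simp
        rw [e]
        refine (abs_integral_le_integral_abs).trans ?_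
        refine (integral_mono ((integrable_const _).sub (iy y)).abs (integrable_const c)
          fun x' => hc x x' y).trans ?_
        simp
      refine (integral_mono ((ly y).sub (memLp_const _)).integrable_sq (integrable_const _)
        hpt).trans ?_
      simp
    have h3 : ν[(fun x => f (x, y)) ^ 2] = ∫ x, f (x, y) ^ 2 ∂ν := rfl
    rw [h3] at h1
    have h4 : g y = ∫ x, f (x, y) ∂ν := rfl
    rw [h4]; linarith
  rw [variance_eq_sub lf, variance_eq_sub lg]
  have isq : Integrable (fun w => f w ^ 2) (ν.prod ρ) := lf.integrable_sq
  have e1 : ∫ w, f w ∂(ν.prod ρ) = ∫ y, g y ∂ρ :=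
    integral_prod_symm _ (lf.integrable (by norm_num))
  have e2 : ∫ w, f w ^ 2 ∂(ν.prod ρ) = ∫ y, ∫ x, f (x, y) ^ 2 ∂ν ∂ρ :=
    integral_prod_symm _ isq
  have h5 : ∫ y, ∫ x, f (x, y) ^ 2 ∂ν ∂ρ ≤ c ^ 2 + ∫ y, g y ^ 2 ∂ρ := by
    refine (integral_mono isq.integral_prod_right ((integrable_const _).add lg.integrable_sq)
      hvy).trans (le_of_eq ?_)
    rw [integral_add' (integrable_const _) lg.integrable_sq]
    simp
  simp only [Pi.pow_apply]
  rw [e1, e2]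
  linarith

/-- A bounded-differences (Efron-Stein) inequality for the variance. -/
theorem variance_pi_le_of_bounded_differences {α : Type*} [MeasurableSpace α] {c : ℝ} :
    ∀ {n : ℕ} (ν : Fin n → Measure α) [∀ i, IsProbabilityMeasure (ν i)] {f : (Fin n → α) → ℝ}
      (_ : Measurable f) {B : ℝ} (_ : ∀ x, |f x| ≤ B)
      (_ : ∀ x i y, |f (Function.update x i y) - f x| ≤ c),
      Var[f; Measure.pi ν] ≤ n * c ^ 2 := by
  intro n
  induction n with
  | zero =>
    intro ν _ f hf B hB hc
    have e : f = fun _ => f default := by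
      ext x; rw [Subsingleton.elim x default]
    rw [e, variance_eq_sub (memLp_const _)]
    simp
  | succ n ih =>
    intro ν _ f hf B hB hc
    have hmp := measurePreserving_piFinSuccAbove ν 0
    set e := MeasurableEquiv.piFinSuccAbove (fun _ : Fin (n + 1) => α) 0 with he
    have hes : ∀ x y, e.symm (x, y) = Fin.cons x y := fun x y => by
      simp only [he, MeasurableEquiv.piFinSuccAbove_symm_apply, Fin.insertNthEquiv_zero]
      rfl
    have h1 : Var[f; Measure.pi ν] =
        Var[fun w => f (e.symm w); (ν 0).prod (Measure.pi fun j => ν (Fin.succAbove 0 j))] := by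
      rw [← hmp.variance_fun_comp (f := fun w => f (e.symm w))
        (hf.comp e.symm.measurable).aemeasurable]
      simp
    have hc1 : ∀ x x' y, |f (e.symm (x, y)) - f (e.symm (x', y))| ≤ c := by
      intro x x' y
      have := hc (Fin.cons x' y) 0 x
      rwa [Fin.update_cons_zero, ← hes, ← hes] at this
    have hfm : Measurable fun w => f (e.symm w) := hf.comp e.symm.measurable
    have iy : ∀ y, Integrable (fun x => f (e.symm (x, y))) (ν 0) := fun y =>
      integrable_of_bound (hfm.comp measurable_prodMk_right) fun x => hB _
    rw [h1]
    refine (variance_prod_le _ _ hfm (fun w => hB _) hc1).trans ?_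
    -- Averaging over coordinate `0` preserves the differences bound `c` in the remaining
    -- coordinates, so the induction hypothesis applies.
    have h2 := ih (fun j => ν (Fin.succAbove 0 j)) (f := fun y => ∫ x, f (e.symm (x, y)) ∂(ν 0))
      (hfm.stronglyMeasurable.integral_prod_left' (μ := ν 0)).measurable (B := B) ?_ ?_
    · push_cast
      linarith
    · intro y
      refine (abs_integral_le_integral_abs).trans ?_
      refine (integral_mono (iy y).abs (integrable_const B) fun x => hB _).trans ?_
      simp
    · intro y i a
      rw [← integral_sub (iy _) (iy _)]
      refine (abs_integral_le_integral_abs).trans ?_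
      refine (integral_mono ((iy _).sub (iy _)).abs (integrable_const c) fun x => ?_).trans ?_
      · have := hc (Fin.cons x y) i.succ a
        rwa [← Fin.cons_update, ← hes, ← hes] at this
      · simp

theorem integral_abs_sub_le_sqrt {Ω : Type*} [MeasurableSpace Ω] {P : Measure Ω}
    [IsProbabilityMeasure P] {f : Ω → ℝ} (hf : MemLp f 2 P) :
    ∫ ω, |f ω - ∫ ω, f ω ∂P| ∂P ≤ √(Var[f; P]) := by
  apply Real.le_sqrt_of_sq_le
  have hg : MemLp (fun ω => |f ω - ∫ ω, f ω ∂P|) 2 P := (hf.sub (memLp_const _)).abs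
  have h := variance_eq_sub hg
  have h0 := variance_nonneg (fun ω => |f ω - ∫ ω, f ω ∂P|) P
  rw [h] at h0
  rw [variance_eq_integral hf.aestronglyMeasurable.aemeasurable]
  simp only [Pi.pow_apply, sq_abs] at h0
  linarith

/-! ### Sample covariances and the size of their resolvents along a class mean. -/

variable {p n k : ℕ} {z : ℝ}

/-- The full sample covariance `(1/n) ∑ x_j x_jᵀ`. -/
noncomputable def sampleCov (x : Fin n → EuclideanSpace ℝ (Fin p)) : Matrix (Fin p) (Fin p) ℝ :=
  (1 / (n : ℝ)) • ∑ j, outerSelf (x j)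

theorem outerSelf_posSemidef (x : EuclideanSpace ℝ (Fin p)) : (outerSelf x).PosSemidef := by
  refine posSemidef_real_iff.2 ⟨by rw [outerSelf_eq_vecMulVec, transpose_vecMulVec], fun v => ?_⟩
  rw [outerSelf_eq_vecMulVec, vecMulVec_mulVec]
  simp only [dotProduct_smul, dotProduct_comm x.ofLp v, MulOpposite.smul_eq_mul_unop,
    MulOpposite.unop_op]
  exact mul_self_nonneg _

theorem sampleCovWithout_posSemidef (x : Fin n → EuclideanSpace ℝ (Fin p)) (i : Fin n) :
    (sampleCovWithout x i).PosSemidef :=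
  (posSemidef_sum _ fun j _ => outerSelf_posSemidef (x j)).smul (by positivity)

theorem sampleCov_posSemidef (x : Fin n → EuclideanSpace ℝ (Fin p)) :
    (sampleCov x).PosSemidef :=
  (posSemidef_sum _ fun j _ => outerSelf_posSemidef (x j)).smul (by positivity)

theorem sampleCov_eq_add (x : Fin n → EuclideanSpace ℝ (Fin p)) (i : Fin n) :
    sampleCov x = sampleCovWithout x i + (1 / (n : ℝ)) • vecMulVec (x i).ofLp (x i).ofLp := by
  rw [sampleCov, sampleCovWithout, ← smul_add, ← outerSelf_eq_vecMulVec,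
    Finset.sum_erase_add _ _ (Finset.mem_univ i)]

theorem sampleCovWithout_update (x : Fin n → EuclideanSpace ℝ (Fin p)) (i : Fin n)
    (y : EuclideanSpace ℝ (Fin p)) :
    sampleCovWithout (Function.update x i y) i = sampleCovWithout x i := by
  rw [sampleCovWithout, sampleCovWithout]
  congr 1
  refine Finset.sum_congr rfl fun j hj => ?_
  rw [Function.update_of_ne (Finset.ne_of_mem_erase hj)]

theorem continuous_outerSelf : Continuous (outerSelf : EuclideanSpace ℝ (Fin p) → _) := by
  refine continuous_matrix fun a b => ?_
  simp only [outerSelf, of_apply]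
  fun_prop

theorem continuous_sampleCov :
    Continuous (sampleCov : (Fin n → EuclideanSpace ℝ (Fin p)) → _) :=
  Continuous.const_smul (continuous_finsetSum _ fun j _ =>
    continuous_outerSelf.comp (continuous_apply j)) (1 / (n : ℝ))

theorem continuous_sampleCovWithout (i : Fin n) :
    Continuous fun x : Fin n → EuclideanSpace ℝ (Fin p) => sampleCovWithout x i :=
  Continuous.const_smul (continuous_finsetSum _ fun j _ =>
    continuous_outerSelf.comp (continuous_apply j)) (1 / (n : ℝ))

theorem continuous_resolventMat {X : Type*} [TopologicalSpace X]
    {S : X → Matrix (Fin p) (Fin p) ℝ} (hS : Continuous S) (hp : ∀ x, (S x).PosSemidef)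
    (hz : 0 < z) : Continuous fun x => resolventMat (S x) z := by
  have h : Continuous fun x => S x + z • (1 : Matrix (Fin p) (Fin p) ℝ) :=
    hS.add continuous_const
  simp only [resolventMat, Matrix.inv_def, Ring.inverse_eq_inv']
  refine Continuous.smul (h.matrix_det.inv₀ fun x => ?_) h.matrix_adjugate
  exact ((isUnit_iff_isUnit_det _).1 (isUnit_add_smul_one (hp x) hz)).ne_zero

variable {ν : Fin n → Measure (EuclideanSpace ℝ (Fin p))} [∀ i, IsProbabilityMeasure (ν i)]
  {μ : Measure (EuclideanSpace ℝ (Fin p))} [IsProbabilityMeasure μ] {V : ℝ}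

/-- The empirical mean over a set of indices with the same law is close to the mean. -/
theorem integral_empirical_mean_le (h : HasLipschitzVariance μ V) (J : Finset (Fin n))
    (hJ : ∀ j ∈ J, ν j = μ) (hJ0 : 0 < J.card) :
    Integrable (fun x : Fin n → EuclideanSpace ℝ (Fin p) =>
      (meanVec μ - (1 / (J.card : ℝ)) • ∑ j ∈ J, (x j).ofLp) ⬝ᵥ
        (meanVec μ - (1 / (J.card : ℝ)) • ∑ j ∈ J, (x j).ofLp)) (Measure.pi ν) ∧
    ∫ x : Fin n → EuclideanSpace ℝ (Fin p),
      (meanVec μ - (1 / (J.card : ℝ)) • ∑ j ∈ J, (x j).ofLp) ⬝ᵥ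
        (meanVec μ - (1 / (J.card : ℝ)) • ∑ j ∈ J, (x j).ofLp) ∂(Measure.pi ν) ≤
      V * p / J.card := by
  have hN : (0 : ℝ) < J.card := by exact_mod_cast hJ0
  set f : Fin p → (Fin n → EuclideanSpace ℝ (Fin p)) → ℝ :=
    fun a x => ∑ j ∈ J, x j a with hf
  have hev : ∀ (j) (_ : j ∈ J) (a : Fin p), MemLp (fun y : EuclideanSpace ℝ (Fin p) => y a) 2 (ν j) :=
    fun j hj a => by rw [hJ j hj]; exact memLp_apply h.memLp_id a
  have hevp : ∀ (j) (_ : j ∈ J) (a : Fin p),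
      MemLp (fun x : Fin n → EuclideanSpace ℝ (Fin p) => x j a) 2 (Measure.pi ν) :=
    fun j hj a => (hev j hj a).comp_measurePreserving (measurePreserving_eval ν j)
  have hfL : ∀ a, MemLp (f a) 2 (Measure.pi ν) := fun a => memLp_finsetSum _ fun j hj => hevp j hj a
  have hmean : ∀ a, ∫ x, f a x ∂(Measure.pi ν) = J.card * meanVec μ a := by
    intro a
    simp only [hf]
    rw [integral_finsetSum _ fun j hj => (hevp j hj a).integrable (by norm_num)]
    have : ∀ j ∈ J, ∫ x : Fin n → EuclideanSpace ℝ (Fin p), x j a ∂(Measure.pi ν) = meanVec μ a := by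
      intro j hj
      have hmp := measurePreserving_eval ν j
      have := integral_map (μ := Measure.pi ν) hmp.measurable.aemeasurable
        (f := fun y : EuclideanSpace ℝ (Fin p) => y a)
        (by rw [hmp.map_eq]; exact (hev j hj a).aestronglyMeasurable)
      rw [hmp.map_eq, hJ j hj] at this
      exact this.symm
    rw [Finset.sum_congr rfl this]
    simp
  have hvar : ∀ a, Var[f a; Measure.pi ν] ≤ J.card * V := by
    intro a
    -- Summands outside `J` are replaced by `0`, so that additivity of the variance applies over the
    -- whole index set.
    set X : Fin n → EuclideanSpace ℝ (Fin p) → ℝ := fun j y => if j ∈ J then y a else 0 with hX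
    have hXL : ∀ j, MemLp (X j) 2 (ν j) := by
      intro j
      by_cases hj : j ∈ J
      · simpa [hX, hj] using hev j hj a
      · simp [hX, hj]
    have e : f a = ∑ j, fun x : Fin n → EuclideanSpace ℝ (Fin p) => X j (x j) := by
      ext x
      simp [hf, hX]
    rw [e, variance_sum_pi hXL]
    have : ∀ j, Var[X j; ν j] ≤ if j ∈ J then V else 0 := by
      intro j
      by_cases hj : j ∈ J
      · simp only [hX, hj, if_true]
        rw [hJ j hj]; exact h.variance_apply_le a
      · simp only [hX, hj, if_false]
        exact (variance_zero _).le
    refine (Finset.sum_le_sum fun j _ => this j).trans (le_of_eq ?_)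
    simp
  have e : ∀ x : Fin n → EuclideanSpace ℝ (Fin p),
      (meanVec μ - (1 / (J.card : ℝ)) • ∑ j ∈ J, (x j).ofLp) ⬝ᵥ
        (meanVec μ - (1 / (J.card : ℝ)) • ∑ j ∈ J, (x j).ofLp) =
      ∑ a, (1 / (J.card : ℝ)) ^ 2 * (f a x - ∫ x, f a x ∂(Measure.pi ν)) ^ 2 := by
    intro x
    simp only [dotProduct, Pi.sub_apply, Pi.smul_apply, Finset.sum_apply, smul_eq_mul]
    refine Finset.sum_congr rfl fun a _ => ?_
    rw [hmean, hf]
    field_simp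
    ring
  simp_rw [e]
  have hi : ∀ a, Integrable (fun x => (1 / (J.card : ℝ)) ^ 2 *
      (f a x - ∫ x, f a x ∂(Measure.pi ν)) ^ 2) (Measure.pi ν) := fun a =>
    (((hfL a).sub (memLp_const _)).integrable_sq).const_mul _
  refine ⟨integrable_finsetSum _ fun a _ => hi a, ?_⟩
  rw [integral_finsetSum _ fun a _ => hi a]
  have : ∀ a, ∫ x, (1 / (J.card : ℝ)) ^ 2 * (f a x - ∫ x, f a x ∂(Measure.pi ν)) ^ 2
      ∂(Measure.pi ν) ≤ V / J.card := by
    intro a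
    rw [integral_const_mul, ← variance_eq_integral (hfL a).aestronglyMeasurable.aemeasurable]
    refine (mul_le_mul_of_nonneg_left (hvar a) (by positivity)).trans (le_of_eq ?_)
    field_simp
  refine (Finset.sum_le_sum fun a _ => this a).trans (le_of_eq ?_)
  simp
  ring

/-- By Cauchy–Schwarz `S ≥ (|J|/n) u uᵀ` for the empirical mean `u` over `J`, so `u ⬝ Q u ≤ n/|J|`.
Writing `m = u + (m - u)` costs a factor `2` and the error `|m - u|² / z`. -/
theorem meanVec_form_resolventMat_le {S : Matrix (Fin p) (Fin p) ℝ} (hS : S.PosSemidef)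
    (hz : 0 < z) {m : Fin p → ℝ} (x : Fin n → EuclideanSpace ℝ (Fin p)) (J : Finset (Fin n))
    (hJ0 : 0 < J.card) (hn : 0 < n)
    (hSJ : ∀ v : Fin p → ℝ, 1 / (n : ℝ) * ∑ j ∈ J, (v ⬝ᵥ (x j).ofLp) ^ 2 ≤ v ⬝ᵥ S *ᵥ v) :
    m ⬝ᵥ resolventMat S z *ᵥ m ≤ 2 * (n / J.card) +
      2 / z * ((m - (1 / (J.card : ℝ)) • ∑ j ∈ J, (x j).ofLp) ⬝ᵥ
        (m - (1 / (J.card : ℝ)) • ∑ j ∈ J, (x j).ofLp)) := by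
  have hN : (0 : ℝ) < J.card := by exact_mod_cast hJ0
  have hn' : (0 : ℝ) < n := by exact_mod_cast hn
  set u := (1 / (J.card : ℝ)) • ∑ j ∈ J, (x j).ofLp with hu
  have hA := isResolventBound_resolventMat hS hz
  have h1 : u ⬝ᵥ resolventMat S z *ᵥ u ≤ 1 / ((J.card : ℝ) / n) := by
    refine resolventMat_form_le_inv hS hz (by positivity) fun v => ?_
    refine le_trans ?_ (hSJ v)
    have h2 : (v ⬝ᵥ u) = 1 / (J.card : ℝ) * ∑ j ∈ J, v ⬝ᵥ (x j).ofLp := by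
      rw [hu, dotProduct_smul, dotProduct_sum, smul_eq_mul]
    have h3 := sq_sum_le_card_mul_sum_sq (s := J) (f := fun j => v ⬝ᵥ (x j).ofLp)
    rw [h2, mul_pow]
    calc (J.card : ℝ) / n * ((1 / (J.card : ℝ)) ^ 2 * (∑ j ∈ J, v ⬝ᵥ (x j).ofLp) ^ 2)
        ≤ (J.card : ℝ) / n * ((1 / (J.card : ℝ)) ^ 2 *
          (J.card * ∑ j ∈ J, (v ⬝ᵥ (x j).ofLp) ^ 2)) := by gcongr
      _ = _ := by field_simp
  have h2 := (hA.posSemidef hz).add_form_le u (m - u)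
  rw [add_sub_cancel] at h2
  have h3 := hA.form_le hz (m - u)
  have e1 : 1 / ((J.card : ℝ) / n) = n / J.card := by field_simp
  have e2 : 2 / z * ((m - u) ⬝ᵥ (m - u)) = 2 * (((m - u) ⬝ᵥ (m - u)) / z) := by ring
  rw [e1] at h1
  rw [e2]
  linarith

theorem sampleCovWithout_form (x : Fin n → EuclideanSpace ℝ (Fin p)) (i : Fin n)
    (v : Fin p → ℝ) : v ⬝ᵥ sampleCovWithout x i *ᵥ v =
      1 / (n : ℝ) * ∑ j ∈ Finset.univ.erase i, (v ⬝ᵥ (x j).ofLp) ^ 2 := by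
  simp only [sampleCovWithout, smul_mulVec, sum_mulVec, dotProduct_smul, dotProduct_sum,
    smul_eq_mul, outerSelf_eq_vecMulVec, vecMulVec_mulVec]
  congr 1
  refine Finset.sum_congr rfl fun j _ => ?_
  simp [pow_two, dotProduct_comm]

/-- In the direction of the mean of a class, the leave-one-out resolvent is small. -/
theorem integral_meanVec_form_le (h : HasLipschitzVariance μ V) (hz : 0 < z) (i : Fin n)
    (J : Finset (Fin n)) (hJi : i ∉ J) (hJ : ∀ j ∈ J, ν j = μ) (hJ0 : 0 < J.card) :
    ∫ x, meanVec μ ⬝ᵥ resolventMat (sampleCovWithout x i) z *ᵥ meanVec μ ∂(Measure.pi ν) ≤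
      2 * (n / J.card) + 2 / z * (V * p / J.card) := by
  have hn : 0 < n := i.pos
  obtain ⟨h1, h2⟩ := integral_empirical_mean_le h J hJ hJ0
  have hb : ∀ x : Fin n → EuclideanSpace ℝ (Fin p),
      IsResolventBound z (resolventMat (sampleCovWithout x i) z) := fun x =>
    isResolventBound_resolventMat (sampleCovWithout_posSemidef x i) hz
  have hi := (integrable_const (μ := Measure.pi ν) (2 * ((n : ℝ) / J.card))).add
    (h1.const_mul (2 / z))
  refine (integral_mono_of_nonneg (Filter.Eventually.of_forall fun x =>
    ((hb x).posSemidef hz).nonneg_real _) hi (Filter.Eventually.of_forall fun x => ?_)).trans ?_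
  · refine meanVec_form_resolventMat_le (sampleCovWithout_posSemidef x i) hz x J hJ0 hn fun v => ?_
    rw [sampleCovWithout_form]
    refine mul_le_mul_of_nonneg_left ?_ (by positivity)
    refine Finset.sum_le_sum_of_subset_of_nonneg (fun j hj => ?_) fun j _ _ => sq_nonneg _
    refine Finset.mem_erase.2 ⟨fun hji => hJi (hji ▸ hj), Finset.mem_univ j⟩
  · rw [integral_add' (integrable_const _) (h1.const_mul (2 / z)),
      integral_const_mul (2 / z), integral_const, probReal_univ, one_smul]
    exact add_le_add_right (mul_le_mul_of_nonneg_left h2 (by positivity)) _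

end ProductSpace

/-! ### Comparison of `tr(C Q)` with `tr(C Q̃_δ)`. -/

section DeterministicEquivalent

theorem IsResolventBound.mono {p : ℕ} {z ζ : ℝ} {A : Matrix (Fin p) (Fin p) ℝ}
    (hA : IsResolventBound z A) (h : ζ ≤ z) : IsResolventBound ζ A :=
  ⟨hA.symm, fun y => (mul_le_mul_of_nonneg_right h (dotProduct_self_nonneg_real _)).trans
    (hA.coercive y)⟩

theorem FormBound.form_le {p : ℕ} {C : Matrix (Fin p) (Fin p) ℝ} {V : ℝ} (hC : FormBound C V)
    (u : Fin p → ℝ) : |u ⬝ᵥ C *ᵥ u| ≤ V * (u ⬝ᵥ u) := by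
  have := hC u u
  rwa [Real.mul_self_sqrt (dotProduct_self_nonneg_real u)] at this

variable {p n k : ℕ} {V z ζ : ℝ}

/-- A rank-one perturbation changes `tr (C Q)` by a bounded quantity. -/
theorem abs_trace_mul_resolventMat_sub_le {S C : Matrix (Fin p) (Fin p) ℝ} (hS : S.PosSemidef)
    (hC : FormBound C V) (hV : 0 ≤ V) (hζ : 0 < ζ) (hz : ζ ≤ z) {a : ℝ} (ha : 0 ≤ a)
    (x : Fin p → ℝ) :
    |(C * resolventMat S z).trace - (C * resolventMat (S + a • vecMulVec x x) z).trace| ≤ V / ζ := by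
  have hz0 : 0 < z := hζ.trans_le hz
  have hA := (isResolventBound_resolventMat hS hz0).mono hz
  rw [resolventMat_add_vecMulVec hS hz0 ha]
  set A := resolventMat S z
  set D := x ⬝ᵥ A *ᵥ x with hD
  have hD0 : 0 ≤ D := (hA.posSemidef hζ).nonneg_real x
  have h1 := hC.form_le (A *ᵥ x)
  have h2 := hA.mulVec_self_le hζ x
  rw [Matrix.mul_sub, trace_sub, sub_sub_cancel, Matrix.mul_smul, trace_smul,
    trace_mul_vecMulVec_eq, smul_eq_mul, abs_mul, abs_of_nonneg (by positivity)]
  calc a / (1 + a * D) * |(A *ᵥ x) ⬝ᵥ C *ᵥ (A *ᵥ x)|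
      ≤ a / (1 + a * D) * (V * (D / ζ)) := by
        gcongr
        exact h1.trans (mul_le_mul_of_nonneg_left h2 hV)
    _ = a * D / (1 + a * D) * (V / ζ) := by ring
    -- The ratio `aD/(1 + aD)` saturates at `1`, so the bound does not depend on the size of `x`.
    _ ≤ 1 * (V / ζ) := by
        gcongr
        rw [div_le_one (by positivity)]
        linarith
    _ = V / ζ := one_mul _

theorem abs_trace_mul_le {N M : Matrix (Fin p) (Fin p) ℝ} {b : ℝ} (h : ∀ i j, |M i j| ≤ b) :
    |(N * M).trace| ≤ ∑ i, ∑ j, |N i j| * b := by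
  simp only [trace, diag_apply, Matrix.mul_apply]
  refine (Finset.abs_sum_le_sum_abs _ _).trans (Finset.sum_le_sum fun i _ => ?_)
  refine (Finset.abs_sum_le_sum_abs _ _).trans (Finset.sum_le_sum fun j _ => ?_)
  rw [abs_mul]
  exact mul_le_mul_of_nonneg_left (h j i) (abs_nonneg _)

theorem trace_mul_expMat {Ω : Type*} [MeasurableSpace Ω] {P : Measure Ω}
    {M : Ω → Matrix (Fin p) (Fin p) ℝ} (hM : ∀ i j, Integrable (fun ω => M ω i j) P)
    (N : Matrix (Fin p) (Fin p) ℝ) :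
    (N * expMat P M).trace = ∫ ω, (N * M ω).trace ∂P := by
  simp only [trace, diag_apply, Matrix.mul_apply, expMat, of_apply]
  have hi : ∀ i j, Integrable (fun ω => N i j * M ω j i) P := fun i j => (hM j i).const_mul _
  rw [integral_finsetSum Finset.univ fun i _ => integrable_finsetSum Finset.univ fun j _ => hi i j]
  refine Finset.sum_congr rfl fun i _ => ?_
  rw [integral_finsetSum Finset.univ fun j _ => hi i j]
  refine Finset.sum_congr rfl fun j _ => ?_
  rw [integral_const_mul]

/-- Measurability and boundedness of `tr (N M)` for a continuous field of resolvents `M`. -/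
theorem integrable_trace_mul {X : Type*} [TopologicalSpace X] [MeasurableSpace X]
    [OpensMeasurableSpace X] {P : Measure X} [IsFiniteMeasure P]
    {M : X → Matrix (Fin p) (Fin p) ℝ} (hM : Continuous M) (hz : 0 < z)
    (hb : ∀ x, IsResolventBound z (M x)) (N : Matrix (Fin p) (Fin p) ℝ) :
    Measurable (fun x => (N * M x).trace) ∧ Integrable (fun x => (N * M x).trace) P := by
  have hm : Measurable (fun x => (N * M x).trace) :=
    ((continuous_const.matrix_mul hM).matrix_trace).measurable
  exact ⟨hm, integrable_of_bound hm fun x => abs_trace_mul_le fun i j => (hb x).abs_apply_le hz i j⟩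

theorem integrable_apply_resolvent {X : Type*} [TopologicalSpace X] [MeasurableSpace X]
    [OpensMeasurableSpace X] {P : Measure X} [IsFiniteMeasure P]
    {M : X → Matrix (Fin p) (Fin p) ℝ} (hM : Continuous M) (hz : 0 < z)
    (hb : ∀ x, IsResolventBound z (M x)) (i j : Fin p) : Integrable (fun x => M x i j) P :=
  integrable_of_bound ((hM.matrix_elem i j).measurable) fun x => (hb x).abs_apply_le hz i j

theorem HasLipschitzVariance.formBound {μ : Measure (EuclideanSpace ℝ (Fin p))}
    [IsProbabilityMeasure μ] (h : HasLipschitzVariance μ V) : FormBound (covMat μ) V :=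
  h.abs_dotProduct_covMat_le

theorem trace_popCov_mul_eq (μ : Measure (EuclideanSpace ℝ (Fin p)))
    (A : Matrix (Fin p) (Fin p) ℝ) :
    (popCov μ * A).trace = (covMat μ * A).trace + meanVec μ ⬝ᵥ A *ᵥ meanVec μ := by
  rw [popCov_eq_add, add_mul, trace_add, trace_mul_comm (vecMulVec _ _), trace_mul_vecMulVec_eq]

/-! ### Concentration of traces of the sample resolvent. -/

section Sample

variable {ν : Fin n → Measure (EuclideanSpace ℝ (Fin p))} [∀ i, IsProbabilityMeasure (ν i)]

theorem isResolventBound_sample (hζ : 0 < ζ) (hz : ζ ≤ z) (x : Fin n → EuclideanSpace ℝ (Fin p)) :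
    IsResolventBound ζ (resolventMat (sampleCov x) z) :=
  (isResolventBound_resolventMat (sampleCov_posSemidef x) (hζ.trans_le hz)).mono hz

theorem isResolventBound_sampleWithout (hζ : 0 < ζ) (hz : ζ ≤ z)
    (x : Fin n → EuclideanSpace ℝ (Fin p)) (i : Fin n) :
    IsResolventBound ζ (resolventMat (sampleCovWithout x i) z) :=
  (isResolventBound_resolventMat (sampleCovWithout_posSemidef x i) (hζ.trans_le hz)).mono hz

theorem continuous_resolvent_sample (hz : 0 < z) :
    Continuous fun x : Fin n → EuclideanSpace ℝ (Fin p) => resolventMat (sampleCov x) z :=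
  continuous_resolventMat continuous_sampleCov sampleCov_posSemidef hz

theorem continuous_resolvent_sampleWithout (hz : 0 < z) (i : Fin n) :
    Continuous fun x : Fin n → EuclideanSpace ℝ (Fin p) =>
      resolventMat (sampleCovWithout x i) z :=
  continuous_resolventMat (continuous_sampleCovWithout i)
    (fun x => sampleCovWithout_posSemidef x i) hz

theorem abs_trace_sampleWithout_sub_le {C : Matrix (Fin p) (Fin p) ℝ} (hC : FormBound C V)
    (hV : 0 ≤ V) (hζ : 0 < ζ) (hz : ζ ≤ z) (x : Fin n → EuclideanSpace ℝ (Fin p)) (i : Fin n) :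
    |(C * resolventMat (sampleCovWithout x i) z).trace -
      (C * resolventMat (sampleCov x) z).trace| ≤ V / ζ := by
  rw [sampleCov_eq_add x i]
  exact abs_trace_mul_resolventMat_sub_le (sampleCovWithout_posSemidef x i) hC hV hζ hz
    (by positivity) _

/-- Concentration of `tr (C Q)`. -/
theorem integral_abs_trace_sub_le {C : Matrix (Fin p) (Fin p) ℝ} (hC : FormBound C V)
    (hV : 0 ≤ V) (hζ : 0 < ζ) (hz : ζ ≤ z) :
    ∫ x, |(C * resolventMat (sampleCov x) z).trace -
      ∫ x, (C * resolventMat (sampleCov x) z).trace ∂(Measure.pi ν)| ∂(Measure.pi ν) ≤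
      2 * V * √n / ζ := by
  have hz0 : 0 < z := hζ.trans_le hz
  have hm := (integrable_trace_mul (P := Measure.pi ν) (continuous_resolvent_sample hz0) hζ
    (fun x => isResolventBound_sample hζ hz x) C).1
  have hB : ∀ x : Fin n → EuclideanSpace ℝ (Fin p),
      |(C * resolventMat (sampleCov x) z).trace| ≤ ∑ i, ∑ j, |C i j| * (1 / ζ) := fun x =>
    abs_trace_mul_le fun i j => (isResolventBound_sample hζ hz x).abs_apply_le hζ i j
  refine (integral_abs_sub_le_sqrt (memLp_two_of_bound hm hB)).trans ?_
  -- Changing column `i` leaves the leave-one-out resolvent unchanged; passing through it twice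
  -- gives the increment `2V/ζ`.
  have h := variance_pi_le_of_bounded_differences ν hm hB (c := 2 * V / ζ) fun x i y => by
    have h1 := abs_le.1 (abs_trace_sampleWithout_sub_le hC hV hζ hz (Function.update x i y) i)
    have h2 := abs_le.1 (abs_trace_sampleWithout_sub_le hC hV hζ hz x i)
    rw [sampleCovWithout_update] at h1
    have e : 2 * V / ζ = V / ζ + V / ζ := by ring
    rw [e, abs_le]
    constructor <;> linarith
  refine (Real.sqrt_le_sqrt h).trans (le_of_eq ?_)
  rw [Real.sqrt_mul (Nat.cast_nonneg n), Real.sqrt_sq (by positivity)]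
  ring

/-- Concentration of `tr (Σ Q_{-i})` around the mean of `tr (Σ Q_{-r})`. -/
theorem integral_abs_trace_popCov_sub_le {μ : Measure (EuclideanSpace ℝ (Fin p))}
    [IsProbabilityMeasure μ] (h : HasLipschitzVariance μ V) (hζ : 0 < ζ) (hz : ζ ≤ z)
    (i r : Fin n) {e : ℝ}
    (he : ∀ i : Fin n, ∫ x, meanVec μ ⬝ᵥ resolventMat (sampleCovWithout x i) z *ᵥ meanVec μ
      ∂(Measure.pi ν) ≤ e) :
    ∫ x, |(popCov μ * resolventMat (sampleCovWithout x i) z).trace -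
      ∫ x, (popCov μ * resolventMat (sampleCovWithout x r) z).trace ∂(Measure.pi ν)|
        ∂(Measure.pi ν) ≤ 2 * V / ζ + 2 * V * √n / ζ + 2 * e := by
  have hz0 : 0 < z := hζ.trans_le hz
  have hV := h.nonneg
  have hC := h.formBound
  set m := meanVec μ
  set ψ : (Fin n → EuclideanSpace ℝ (Fin p)) → ℝ :=
    fun x => (covMat μ * resolventMat (sampleCov x) z).trace with hψ
  have iψ : Integrable ψ (Measure.pi ν) := (integrable_trace_mul (continuous_resolvent_sample hz0) hζ
    (fun x => isResolventBound_sample hζ hz x) _).2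
  have hiT : ∀ (N : Matrix (Fin p) (Fin p) ℝ) j, Integrable
      (fun x : Fin n → EuclideanSpace ℝ (Fin p) =>
        (N * resolventMat (sampleCovWithout x j) z).trace) (Measure.pi ν) :=
    fun N j => (integrable_trace_mul (continuous_resolvent_sampleWithout hz0 j) hζ
      (fun x => isResolventBound_sampleWithout hζ hz x j) N).2
  have hm0 : ∀ (x : Fin n → EuclideanSpace ℝ (Fin p)) j,
      0 ≤ m ⬝ᵥ resolventMat (sampleCovWithout x j) z *ᵥ m := fun x j =>
    ((isResolventBound_sampleWithout hζ hz x j).posSemidef hζ).nonneg_real m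
  have hspl : ∀ (x : Fin n → EuclideanSpace ℝ (Fin p)) j,
      (popCov μ * resolventMat (sampleCovWithout x j) z).trace =
        (covMat μ * resolventMat (sampleCovWithout x j) z).trace +
          m ⬝ᵥ resolventMat (sampleCovWithout x j) z *ᵥ m := fun x j =>
    trace_popCov_mul_eq μ _
  have im : ∀ j, Integrable (fun x : Fin n → EuclideanSpace ℝ (Fin p) =>
      m ⬝ᵥ resolventMat (sampleCovWithout x j) z *ᵥ m) (Measure.pi ν) := fun j => by
    refine ((hiT (popCov μ) j).sub (hiT (covMat μ) j)).congr
      (Filter.Eventually.of_forall fun x => ?_)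
    simp only [Pi.sub_apply, hspl]; ring
  -- The traces for different removed indices are compared through `ψ`, which involves all columns.
  -- The mean part is nonnegative and costs at most `e` on average, once for `r` and once for `i`.
  have hEr : |∫ x, (popCov μ * resolventMat (sampleCovWithout x r) z).trace ∂(Measure.pi ν) -
      ∫ x, ψ x ∂(Measure.pi ν)| ≤ V / ζ + e := by
    rw [← integral_sub (hiT _ r) iψ]
    refine (abs_integral_le_integral_abs).trans ?_
    have : ∀ x : Fin n → EuclideanSpace ℝ (Fin p),
        |(popCov μ * resolventMat (sampleCovWithout x r) z).trace - ψ x| ≤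
          V / ζ + m ⬝ᵥ resolventMat (sampleCovWithout x r) z *ᵥ m := by
      intro x
      have h1 := abs_trace_sampleWithout_sub_le hC hV hζ hz x r
      rw [hspl, add_sub_right_comm]
      refine (abs_add_le _ _).trans (add_le_add h1 ?_)
      rw [abs_of_nonneg (hm0 x r)]
    refine (integral_mono ((hiT _ r).sub iψ).abs ((integrable_const _).add (im r)) this).trans ?_
    rw [integral_add' (integrable_const _) (im r), integral_const, probReal_univ, one_smul]
    exact add_le_add_right (he r) _
  have hpt : ∀ x : Fin n → EuclideanSpace ℝ (Fin p),
      |(popCov μ * resolventMat (sampleCovWithout x i) z).trace -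
      ∫ x, (popCov μ * resolventMat (sampleCovWithout x r) z).trace ∂(Measure.pi ν)| ≤
      (V / ζ + (V / ζ + e)) + (|ψ x - ∫ x, ψ x ∂(Measure.pi ν)| +
        m ⬝ᵥ resolventMat (sampleCovWithout x i) z *ᵥ m) := by
    intro x
    have h1 := abs_le.1 (abs_trace_sampleWithout_sub_le hC hV hζ hz x i)
    have h2 := abs_le.1 hEr
    have h3 := hm0 x i
    have h4 := abs_le.1 (le_refl |ψ x - ∫ x, ψ x ∂(Measure.pi ν)|)
    rw [hspl, abs_le]
    constructor <;> linarith
  have iab : Integrable (fun x => |ψ x - ∫ x, ψ x ∂(Measure.pi ν)|) (Measure.pi ν) :=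
    (iψ.sub (integrable_const _)).abs
  have isum : Integrable (fun x => |ψ x - ∫ x, ψ x ∂(Measure.pi ν)| +
        m ⬝ᵥ resolventMat (sampleCovWithout x i) z *ᵥ m) (Measure.pi ν) := iab.add (im i)
  refine (integral_mono ((hiT _ i).sub (integrable_const _)).abs
    ((integrable_const _).add isum) hpt).trans ?_
  rw [integral_add' (integrable_const _) isum, integral_const, probReal_univ, one_smul,
    integral_add iab (im i)]
  have h1 := integral_abs_trace_sub_le (ν := ν) hC hV hζ hz
  have h2 := he i
  have e1 : 2 * V / ζ = V / ζ + V / ζ := by ring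
  rw [e1]
  linarith

end Sample

/-! ### Leave-one-out expansion of `tr(C (Q - Q̃_δ))`. -/

section Main

variable {μ : Fin k → Measure (EuclideanSpace ℝ (Fin p))}
  {cls : Fin n → Fin k} {T : ℝ} {δ : Fin k → ℝ}

theorem sum_classSize_mul {M : Type*} [AddCommGroup M] [Module ℝ M] (f : Fin k → M) :
    ∑ i, f (cls i) = ∑ l, (classSize cls l : ℝ) • f l := by
  rw [← Finset.sum_fiberwise (s := Finset.univ) (g := cls)]
  refine Finset.sum_congr rfl fun l _ => ?_
  rw [Finset.sum_congr rfl (g := fun _ => f l) fun i hi => by rw [(Finset.mem_filter.1 hi).2]]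
  rw [Finset.sum_const, classSize, Nat.cast_smul_eq_nsmul]

theorem sigmaOf_eq_sum :
    sigmaOf μ cls δ = (1 / (n : ℝ)) • ∑ i, (1 / (1 + δ (cls i))) • popCov (μ (cls i)) := by
  rw [sum_classSize_mul (cls := cls) fun l => (1 / (1 + δ l)) • popCov (μ l), Finset.smul_sum,
    sigmaOf]
  refine Finset.sum_congr rfl fun l _ => ?_
  rw [smul_smul, smul_smul]
  congr 1
  ring

/-- The summand of the expansion of `tr (C (Q - Q̃))`. -/
noncomputable def bracket (μ : Fin k → Measure (EuclideanSpace ℝ (Fin p))) (cls : Fin n → Fin k)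
    (z : ℝ) (δ : Fin k → ℝ) (C : Matrix (Fin p) (Fin p) ℝ) (i : Fin n)
    (x : Fin n → EuclideanSpace ℝ (Fin p)) : ℝ :=
  (popCov (μ (cls i)) * (tildeQ μ cls z δ * C * resolventMat (sampleCov x) z)).trace /
      (1 + δ (cls i)) -
    (x i).ofLp ⬝ᵥ (tildeQ μ cls z δ * C * resolventMat (sampleCov x) z) *ᵥ (x i).ofLp

/-- Sherman–Morrison makes the dependence on column `i` explicit: the remaining resolvent is
independent of `y`, which puts the bracket in the form treated by `abs_integral_bracket_le`. -/
theorem bracket_update (hz : 0 < z) (C : Matrix (Fin p) (Fin p) ℝ) (i : Fin n)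
    (x : Fin n → EuclideanSpace ℝ (Fin p)) (y : EuclideanSpace ℝ (Fin p)) :
    bracket μ cls z δ C i (Function.update x i y) =
      (popCov (μ (cls i)) * (tildeQ μ cls z δ * C *
        resolventMat (sampleCovWithout x i) z)).trace / (1 + δ (cls i)) -
      1 / (n : ℝ) * (1 / (1 + 1 / (n : ℝ) *
          (y.ofLp ⬝ᵥ resolventMat (sampleCovWithout x i) z *ᵥ y.ofLp))) *
        ((resolventMat (sampleCovWithout x i) z *ᵥ y.ofLp) ⬝ᵥ popCov (μ (cls i)) *ᵥ
          (tildeQ μ cls z δ *ᵥ (C *ᵥ (resolventMat (sampleCovWithout x i) z *ᵥ y.ofLp)))) /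
            (1 + δ (cls i)) -
      1 / (1 + 1 / (n : ℝ) * (y.ofLp ⬝ᵥ resolventMat (sampleCovWithout x i) z *ᵥ y.ofLp)) *
        (y.ofLp ⬝ᵥ (tildeQ μ cls z δ * C * resolventMat (sampleCovWithout x i) z) *ᵥ y.ofLp) := by
  have hS := sampleCovWithout_posSemidef x i
  rw [bracket, sampleCov_eq_add _ i, sampleCovWithout_update, Function.update_self,
    ← mulVec_mulVec _ _ (resolventMat _ z),
    resolventMat_add_vecMulVec_mulVec hS hz (by positivity),
    resolventMat_add_vecMulVec hS hz (by positivity)]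
  simp only [Matrix.mul_sub, trace_sub, Matrix.mul_smul, trace_smul, smul_eq_mul, mulVec_smul,
    dotProduct_smul, mul_vecMulVec, trace_vecMulVec, mulVec_mulVec]
  rw [dotProduct_comm ((popCov (μ (cls i)) * _) *ᵥ _)]
  simp only [Matrix.mul_assoc]
  ring

/-- Resolvent identity `Q - Q̃ = Q (Σ_δ - S) Q̃`, with both `Σ_δ` and the sample covariance `S`
written as averages over the `n` columns. -/
theorem trace_resolvent_sub_eq (hμ : ∀ l, MemLp id 2 (μ l)) (hδ : ∀ l, 0 ≤ δ l) (hz : 0 < z)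
    (C : Matrix (Fin p) (Fin p) ℝ) (x : Fin n → EuclideanSpace ℝ (Fin p)) :
    (C * resolventMat (sampleCov x) z).trace - (C * tildeQ μ cls z δ).trace =
      1 / (n : ℝ) * ∑ i, bracket μ cls z δ C i x := by
  set Q := resolventMat (sampleCov x) z
  set R := tildeQ μ cls z δ
  have hR : (sigmaOf μ cls δ + z • (1 : Matrix (Fin p) (Fin p) ℝ)) * R = 1 :=
    mul_resolventMat (sigmaOf_posSemidef hμ hδ) hz
  have hQ : Q * (sampleCov x + z • (1 : Matrix (Fin p) (Fin p) ℝ)) = 1 :=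
    resolventMat_mul (sampleCov_posSemidef x) hz
  have e1 : Q - R = Q * (sigmaOf μ cls δ - sampleCov x) * R := by
    have : sigmaOf μ cls δ - sampleCov x =
        (sigmaOf μ cls δ + z • (1 : Matrix (Fin p) (Fin p) ℝ)) -
          (sampleCov x + z • (1 : Matrix (Fin p) (Fin p) ℝ)) := by abel
    rw [this, Matrix.mul_sub, Matrix.sub_mul, Matrix.mul_assoc, hR, hQ, Matrix.mul_one,
      Matrix.one_mul]
  have e2 : (C * (Q - R)).trace = ((sigmaOf μ cls δ - sampleCov x) * (R * C * Q)).trace := by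
    rw [e1, trace_mul_comm]
    conv_rhs => rw [trace_mul_comm]
    rw [trace_mul_comm, ← Matrix.mul_assoc, trace_mul_comm]
    simp only [Matrix.mul_assoc]
  rw [← trace_sub, ← Matrix.mul_sub, e2, Matrix.sub_mul, trace_sub, sigmaOf_eq_sum, sampleCov,
    Matrix.smul_mul, Matrix.smul_mul, trace_smul, trace_smul, ← smul_sub, smul_eq_mul,
    Finset.sum_mul, Finset.sum_mul, trace_sum, trace_sum, ← Finset.sum_sub_distrib]
  congr 1
  refine Finset.sum_congr rfl fun i _ => ?_
  rw [bracket, Matrix.smul_mul, trace_smul, outerSelf_eq_vecMulVec, trace_mul_comm (vecMulVec _ _),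
    trace_mul_vecMulVec_eq, smul_eq_mul]
  ring

variable [∀ l, IsProbabilityMeasure (μ l)]

theorem integrable_bracket (h : ∀ l, HasLipschitzVariance (μ l) V) (hδ : ∀ l, 0 ≤ δ l)
    (hz : 0 < z) {C : Matrix (Fin p) (Fin p) ℝ} (hC : FormBound C V) (hV : 0 ≤ V) (i : Fin n) :
    Integrable (bracket μ cls z δ C i) (Measure.pi fun i => μ (cls i)) := by
  have hμ := fun l => (h l).memLp_id
  have hcQ : Continuous fun x : Fin n → EuclideanSpace ℝ (Fin p) => resolventMat (sampleCov x) z :=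
    continuous_resolvent_sample hz
  have hR := isResolventBound_tildeQ (cls := cls) hμ hδ hz
  have hQ := fun x : Fin n → EuclideanSpace ℝ (Fin p) => isResolventBound_sample hz le_rfl x
  refine Integrable.sub ?_ ?_
  · refine Integrable.div_const ?_ _
    simp only [← Matrix.mul_assoc (popCov (μ (cls i)))]
    exact (integrable_trace_mul hcQ hz hQ _).2
  · have hmp := measurePreserving_eval (fun i => μ (cls i)) i
    have i1 : Integrable (fun x : Fin n → EuclideanSpace ℝ (Fin p) => (x i).ofLp ⬝ᵥ (x i).ofLp)
        (Measure.pi fun i => μ (cls i)) :=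
      hmp.integrable_comp_of_integrable (integrable_dotProduct_self (hμ (cls i)))
    have hx : Continuous fun x : Fin n → EuclideanSpace ℝ (Fin p) => (x i).ofLp :=
      (PiLp.continuous_ofLp 2 _).comp (continuous_apply i)
    refine (i1.const_mul (V / z ^ 2)).mono' (Continuous.measurable ?_).aestronglyMeasurable
      (Filter.Eventually.of_forall fun x => ?_)
    · exact hx.dotProduct ((continuous_const.matrix_mul hcQ).matrix_mulVec hx)
    · set y := (x i).ofLp
      set Q := resolventMat (sampleCov x) z
      have e1 : y ⬝ᵥ (tildeQ μ cls z δ * C * Q) *ᵥ y =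
          (tildeQ μ cls z δ *ᵥ y) ⬝ᵥ C *ᵥ (Q *ᵥ y) := by
        rw [mulVec_dotProduct_of_symm hR.symm, mulVec_mulVec, mulVec_mulVec]
      have h2 : ∀ M, IsResolventBound z M → √((M *ᵥ y) ⬝ᵥ (M *ᵥ y)) ≤ √(y ⬝ᵥ y) / z := by
        intro M hM
        have := Real.sqrt_le_sqrt (hM.mulVec_self_le_sq hz y)
        rwa [Real.sqrt_div (dotProduct_self_nonneg_real _), Real.sqrt_sq hz.le] at this
      rw [e1, Real.norm_eq_abs]
      refine (hC _ _).trans ((mul_le_mul_of_nonneg_left (mul_le_mul (h2 _ hR) (h2 _ (hQ x))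
        (Real.sqrt_nonneg _) (by positivity)) hV).trans (le_of_eq ?_))
      rw [div_mul_div_comm, Real.mul_self_sqrt (dotProduct_self_nonneg_real _)]
      ring

/-- Column `i` is integrated first, with weight `w = n_l / n` for its class `l`; the bias term that
remains is then averaged over the other columns by `hη`. -/
theorem abs_integral_bracket_pi_le (h : ∀ l, HasLipschitzVariance (μ l) V) (hT0 : 0 ≤ T)
    (hT : ∀ l, ∫ y, y.ofLp ⬝ᵥ y.ofLp ∂(μ l) ≤ T * n) (hδ : ∀ l, 0 ≤ δ l) (hζ : 0 < ζ)
    (hz : ζ ≤ z) {C : Matrix (Fin p) (Fin p) ℝ} (hC : FormBound C V) (i : Fin n) {η : ℝ}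
    (hη : ∫ x, |(popCov (μ (cls i)) * resolventMat (sampleCovWithout x i) z).trace -
      n * δ (cls i)| ∂(Measure.pi fun i => μ (cls i)) ≤ η) :
    |∫ x, bracket μ cls z δ C i x ∂(Measure.pi fun i => μ (cls i))| ≤
      V * √(T * n / (ζ * ((classSize cls (cls i) : ℝ) / n))) * T / ζ ^ 2 +
        V * T / ζ ^ 2 * η + V * √n / (ζ * √ζ) * (T + 2 * V / ζ) := by
  have hμ := fun l => (h l).memLp_id
  have hz0 : 0 < z := hζ.trans_le hz
  have hV := (h (cls i)).nonneg
  have hn : (0 : ℝ) < n := by exact_mod_cast i.pos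
  have hcs : (0 : ℝ) < classSize cls (cls i) := by
    have : 0 < classSize cls (cls i) := Finset.card_pos.2 ⟨i, by simp⟩
    exact_mod_cast this
  obtain ⟨i1, e1⟩ := integral_pi_eq_integral_update (fun i => μ (cls i)) i
    (integrable_bracket (cls := cls) h hδ hz0 hC hV i)
  have hR := isResolventBound_tildeQ (cls := cls) hμ hδ hz0
  have hpt : ∀ x : Fin n → EuclideanSpace ℝ (Fin p),
      |∫ y, bracket μ cls z δ C i (Function.update x i y) ∂(μ (cls i))| ≤
        (V * √(T * n / (ζ * ((classSize cls (cls i) : ℝ) / n))) * T / ζ ^ 2 +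
          V * √n / (ζ * √ζ) * (T + 2 * V / ζ)) +
        V * T / ζ ^ 2 * |(popCov (μ (cls i)) * resolventMat (sampleCovWithout x i) z).trace -
          n * δ (cls i)| := by
    intro x
    have key := abs_integral_bracket_le (w := (classSize cls (cls i) : ℝ) / n) (h (cls i)) hn hζ
      hT0 (hT (cls i)) (by positivity) (hδ (cls i))
      (isResolventBound_sampleWithout hζ hz x i) (hR.mono hz) hC (fun u => by
        -- `u ⬝ Q̃ u = Q̃u ⬝ Σ_δ Q̃u + z |Q̃u|²`, and `Σ_δ` dominates its own term of index `cls i`.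
        have h1 := classSize_form_le (cls := cls) hμ hδ (cls i) (tildeQ μ cls z δ *ᵥ u)
        have h2 := dotProduct_resolventMat_mulVec (sigmaOf_posSemidef (cls := cls) hμ hδ) hz0 u
        have h3 := mul_nonneg hz0.le (dotProduct_self_nonneg_real (tildeQ μ cls z δ *ᵥ u))
        have e2 : u ⬝ᵥ tildeQ μ cls z δ *ᵥ u =
          u ⬝ᵥ resolventMat (sigmaOf μ cls δ) z *ᵥ u := rfl
        rw [e2, h2]
        exact h1.trans (le_add_of_nonneg_right h3))
    simp_rw [bracket_update hz0]
    refine key.trans (le_of_eq ?_)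
    rw [← trace_popCov_mul (hμ (cls i))]
    have e3 : |1 / (n : ℝ) * (popCov (μ (cls i)) * resolventMat (sampleCovWithout x i) z).trace -
        δ (cls i)| = 1 / n * |(popCov (μ (cls i)) *
          resolventMat (sampleCovWithout x i) z).trace - n * δ (cls i)| := by
      rw [← abs_of_pos (one_div_pos.2 hn), ← abs_mul, mul_sub, abs_of_pos (one_div_pos.2 hn)]
      congr 2
      field_simp
    rw [e3]
    field_simp
    ring
  rw [e1]
  refine (abs_integral_le_integral_abs).trans ?_
  have i2 : Integrable (fun x : Fin n → EuclideanSpace ℝ (Fin p) =>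
      |(popCov (μ (cls i)) * resolventMat (sampleCovWithout x i) z).trace - n * δ (cls i)|)
      (Measure.pi fun i => μ (cls i)) :=
    ((integrable_trace_mul (continuous_resolvent_sampleWithout hz0 i) hζ
      (fun x => isResolventBound_sampleWithout hζ hz x i) _).2.sub (integrable_const _)).abs
  refine (integral_mono i1.abs ((integrable_const _).add (i2.const_mul _)) hpt).trans ?_
  rw [integral_add' (integrable_const _) (i2.const_mul _), integral_const, probReal_univ, one_smul,
    integral_const_mul]
  have := mul_le_mul_of_nonneg_left hη (by positivity : 0 ≤ V * T / ζ ^ 2)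
  linarith

/-- A small class has a bad individual bound, of order `n / √n_l`, but contributes only `n_l` terms:
the class total is of order `n √n_l ≤ n √n`. -/
theorem sum_sqrt_classSize_le (hT0 : 0 ≤ T) (hζ : 0 < ζ) :
    ∑ i, √(T * n / (ζ * ((classSize cls (cls i) : ℝ) / n))) ≤ √(T / ζ) * n * (k * √n) := by
  rw [sum_classSize_mul (cls := cls) fun l => √(T * n / (ζ * ((classSize cls l : ℝ) / n)))]
  have : ∀ l, (classSize cls l : ℝ) • √(T * n / (ζ * ((classSize cls l : ℝ) / n))) ≤
      √(T / ζ) * n * √n := by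
    intro l
    rw [smul_eq_mul]
    rcases (Nat.cast_nonneg (α := ℝ) (classSize cls l)).eq_or_lt with h0 | h0
    · rw [← h0, zero_mul]; positivity
    have hle : (classSize cls l : ℝ) ≤ n := by
      have : classSize cls l ≤ n := (Finset.card_filter_le _ _).trans (by simp)
      exact_mod_cast this
    have e : T * n / (ζ * ((classSize cls l : ℝ) / n)) = T / ζ * (n ^ 2 / classSize cls l) := by
      have : (n : ℝ) ≠ 0 := (h0.trans_le hle).ne'
      field_simp
    rw [e, Real.sqrt_mul (by positivity), Real.sqrt_div (sq_nonneg (n : ℝ)),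
      Real.sqrt_sq (Nat.cast_nonneg n)]
    have e2 : (classSize cls l : ℝ) * (√(T / ζ) * (n / √(classSize cls l : ℝ))) =
        √(T / ζ) * n * √(classSize cls l : ℝ) := by
      have h1 := Real.mul_self_sqrt h0.le
      have h2 : √(classSize cls l : ℝ) ≠ 0 := (Real.sqrt_pos.2 h0).ne'
      field_simp
      rw [pow_two, h1]
      ring
    rw [e2]
    exact mul_le_mul_of_nonneg_left (Real.sqrt_le_sqrt hle) (by positivity)
  refine (Finset.sum_le_sum fun l _ => this l).trans (le_of_eq ?_)
  simp
  ring

theorem abs_integral_trace_sub_le (h : ∀ l, HasLipschitzVariance (μ l) V) (hT0 : 0 ≤ T)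
    (hT : ∀ l, ∫ y, y.ofLp ⬝ᵥ y.ofLp ∂(μ l) ≤ T * n) (hδ : ∀ l, 0 ≤ δ l) (hζ : 0 < ζ)
    (hz : ζ ≤ z) (hn : 0 < n) {C : Matrix (Fin p) (Fin p) ℝ} (hC : FormBound C V) (hV : 0 ≤ V)
    {η : ℝ} (hη : ∀ i, ∫ x, |(popCov (μ (cls i)) * resolventMat (sampleCovWithout x i) z).trace -
      n * δ (cls i)| ∂(Measure.pi fun i => μ (cls i)) ≤ η) :
    |∫ x, (C * resolventMat (sampleCov x) z).trace ∂(Measure.pi fun i => μ (cls i)) -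
        (C * tildeQ μ cls z δ).trace| ≤
      V * T / ζ ^ 2 * √(T / ζ) * (k * √n) + V * T / ζ ^ 2 * η +
        V * √n / (ζ * √ζ) * (T + 2 * V / ζ) := by
  have hμ := fun l => (h l).memLp_id
  have hz0 : 0 < z := hζ.trans_le hz
  have hn' : (0 : ℝ) < n := by exact_mod_cast hn
  have i1 : Integrable (fun x => (C * resolventMat (sampleCov x) z).trace)
      (Measure.pi fun i => μ (cls i)) := (integrable_trace_mul (continuous_resolvent_sample hz0) hζ
    (fun x => isResolventBound_sample hζ hz x) _).2
  have e1 : ∫ x, (C * resolventMat (sampleCov x) z).trace ∂(Measure.pi fun i => μ (cls i)) -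
      (C * tildeQ μ cls z δ).trace = 1 / (n : ℝ) * ∑ i, ∫ x, bracket μ cls z δ C i x
        ∂(Measure.pi fun i => μ (cls i)) := by
    rw [← integral_finsetSum _ fun i _ => integrable_bracket (cls := cls) h hδ hz0 hC hV i,
      ← integral_const_mul]
    simp_rw [← trace_resolvent_sub_eq (cls := cls) hμ hδ hz0]
    rw [integral_sub i1 (integrable_const _)]
    simp
  rw [e1, abs_mul, abs_of_pos (one_div_pos.2 hn')]
  have h1 := (Finset.abs_sum_le_sum_abs _ _).trans (Finset.sum_le_sum fun i (_ : i ∈ Finset.univ) =>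
    abs_integral_bracket_pi_le (cls := cls) h hT0 hT hδ hζ hz hC i (hη i))
  refine (mul_le_mul_of_nonneg_left h1 (by positivity)).trans ?_
  have h2 := sum_sqrt_classSize_le (n := n) (cls := cls) hT0 hζ
  rw [Finset.sum_add_distrib, Finset.sum_add_distrib]
  simp only [Finset.sum_const, Finset.card_univ, Fintype.card_fin, nsmul_eq_mul]
  have e2 : ∑ i, V * √(T * n / (ζ * ((classSize cls (cls i) : ℝ) / n))) * T / ζ ^ 2 =
      V * T / ζ ^ 2 * ∑ i, √(T * n / (ζ * ((classSize cls (cls i) : ℝ) / n))) := by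
    rw [Finset.mul_sum]
    refine Finset.sum_congr rfl fun i _ => by ring
  rw [e2]
  calc _ ≤ 1 / (n : ℝ) * (V * T / ζ ^ 2 * (√(T / ζ) * n * (k * √n)) +
        n * (V * T / ζ ^ 2 * η) + n * (V * √n / (ζ * √ζ) * (T + 2 * V / ζ))) := by gcongr
    _ = _ := by field_simp

end Main

end DeterministicEquivalent

/-! ### The residual of `δ` in the fixed-point system. -/

section Conclusion

variable {p n k : ℕ} {V z ζ T : ℝ} {μ : Fin k → Measure (EuclideanSpace ℝ (Fin p))}
  {cls : Fin n → Fin k} {δ : Fin k → ℝ}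

theorem deltaVec_eq_pi {Ω : Type*} [MeasurableSpace Ω] {P : Measure Ω} [IsProbabilityMeasure P]
    {x : Fin n → Ω → EuclideanSpace ℝ (Fin p)} (hx : ∀ i, HasLaw (x i) (μ (cls i)) P)
    (hi : iIndepFun x P) (hz : 0 < z) (r : Fin k → Fin n) :
    deltaVec P x μ r z =
      deltaVec (Measure.pi fun i => μ (cls i)) (fun i x => x i) μ r z := by
  have hlaw := hi.hasLaw_pi hx
  ext l
  simp only [deltaVec]
  congr 3
  ext a b
  simp only [expMat, of_apply]
  exact hlaw.integral_comp (f := fun x : Fin n → EuclideanSpace ℝ (Fin p) =>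
    resolventMat (sampleCovWithout x (r l)) z a b)
    ((continuous_resolvent_sampleWithout hz (r l)).matrix_elem a b).aestronglyMeasurable

variable [∀ l, IsProbabilityMeasure (μ l)]

/-- `Σ_δ ≥ (n_l/n)/(1 + δ_l) Σ_l`, and `Σ_l` dominates the square of its mean. -/
theorem meanVec_form_tildeQ_le (hμ : ∀ l, MemLp id 2 (μ l)) (hδ : ∀ l, 0 ≤ δ l) (hz : 0 < z)
    (hn : 0 < n) (l : Fin k) (hl : 0 < classSize cls l) :
    meanVec (μ l) ⬝ᵥ tildeQ μ cls z δ *ᵥ meanVec (μ l) ≤ (1 + δ l) * (n / classSize cls l) := by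
  have hn' : (0 : ℝ) < n := by exact_mod_cast hn
  have hl' : (0 : ℝ) < classSize cls l := by exact_mod_cast hl
  have hδl : 0 < 1 + δ l := by linarith [hδ l]
  have e : (1 + δ l) * (n / classSize cls l) = 1 / ((classSize cls l : ℝ) / n / (1 + δ l)) := by
    field_simp
  rw [e]
  refine resolventMat_form_le_inv (sigmaOf_posSemidef hμ hδ) hz (by positivity) fun v => ?_
  refine le_trans (mul_le_mul_of_nonneg_left ?_ (by positivity))
    (classSize_form_le (cls := cls) hμ hδ l v)
  have h := (covMat_posSemidef (hμ l)).nonneg_real v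
  rw [covMat, sub_mulVec, dotProduct_sub, vecMulVec_mulVec] at h
  simp only [dotProduct_smul, MulOpposite.smul_eq_mul_unop, MulOpposite.unop_op,
    dotProduct_comm (meanVec (μ l)) v] at h
  linarith

/-- In the direction of a class mean, the leave-one-out resolvents are `O(√n)`. -/
theorem integral_meanVec_form_le_sqrt (h : ∀ l, HasLipschitzVariance (μ l) V) (hζ : 0 < ζ)
    (hz : ζ ≤ z) {κ G : ℝ} (hκ : 0 < κ) (hG : (p : ℝ) ≤ G * n) (l : Fin k)
    (hl : κ * √n ≤ classSize cls l) (hl2 : 2 ≤ κ * √n) (i : Fin n) :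
    ∫ x, meanVec (μ l) ⬝ᵥ resolventMat (sampleCovWithout x i) z *ᵥ meanVec (μ l)
      ∂(Measure.pi fun i => μ (cls i)) ≤ 4 / κ * (1 + V * G / ζ) * √n := by
  have hn : (0 : ℝ) < n := by exact_mod_cast i.pos
  have hV := (h l).nonneg
  set J := (Finset.univ.filter fun j => cls j = l).erase i with hJ
  -- Removing `i` costs at most one element of the class; since `κ√n ≥ 2`, at least half of `κ√n`
  -- remains.
  have hcard : (κ * √n) / 2 ≤ J.card := by
    have h1 : classSize cls l ≤ J.card + 1 := by
      have := Finset.pred_card_le_card_erase (s := Finset.univ.filter fun j => cls j = l) (a := i)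
      rw [← hJ] at this
      rw [classSize]; omega
    have h2 : (classSize cls l : ℝ) ≤ J.card + 1 := by exact_mod_cast h1
    linarith
  have hJ0 : (0 : ℝ) < J.card := by linarith
  have hs : 0 < √(n : ℝ) := Real.sqrt_pos.2 hn
  have hss : √(n : ℝ) * √n = n := Real.mul_self_sqrt hn.le
  refine (integral_meanVec_form_le (ν := fun i => μ (cls i)) (h l) (hζ.trans_le hz) i J
    (Finset.notMem_erase i _) (fun j hj => ?_) (by exact_mod_cast hJ0)).trans ?_
  · rw [(Finset.mem_filter.1 (Finset.mem_of_mem_erase hj)).2]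
  have h1 : (n : ℝ) / J.card ≤ 2 / κ * √n := by
    rw [div_le_iff₀ hJ0]
    calc (n : ℝ) = 2 / κ * √n * (κ * √n / 2) := by field_simp; rw [pow_two, hss]
      _ ≤ _ := by gcongr
  have h2 : V * p / J.card ≤ V * G * (2 / κ * √n) := by
    calc V * p / J.card ≤ V * (G * n) / J.card := by gcongr
      _ = V * G * (n / J.card) := by ring
      _ ≤ _ := by
        have hG0 : 0 ≤ G := by
          by_contra! hc
          have : (0 : ℝ) ≤ p := Nat.cast_nonneg p
          nlinarith
        gcongr
  have h3 : 2 / z ≤ 2 / ζ := by gcongr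
  have h4 : 0 ≤ V * p / J.card := by positivity
  calc 2 * ((n : ℝ) / J.card) + 2 / z * (V * p / J.card)
      ≤ 2 * (2 / κ * √n) + 2 / ζ * (V * G * (2 / κ * √n)) := by gcongr
    _ = _ := by ring

theorem deltaVec_pi_eq_integral (hz : 0 < z) (r : Fin k → Fin n) (l : Fin k) :
    deltaVec (Measure.pi fun i => μ (cls i)) (fun i x => x i) μ r z l =
      1 / (n : ℝ) * ∫ x, (popCov (μ l) * resolventMat (sampleCovWithout x (r l)) z).trace
        ∂(Measure.pi fun i => μ (cls i)) := by
  rw [deltaVec]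
  congr 1
  exact trace_mul_expMat (fun a b => integrable_apply_resolvent
    (continuous_resolvent_sampleWithout hz (r l)) hz
    (fun x => isResolventBound_sampleWithout hz le_rfl x (r l)) a b) _

theorem deltaVec_pi_nonneg (hμ : ∀ l, MemLp id 2 (μ l)) (hz : 0 < z) (r : Fin k → Fin n)
    (l : Fin k) : 0 ≤ deltaVec (Measure.pi fun i => μ (cls i)) (fun i x => x i) μ r z l := by
  rw [deltaVec_pi_eq_integral hz]
  refine mul_nonneg (by positivity) (integral_nonneg fun x => ?_)
  simp only [trace_popCov_mul (hμ l)]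
  exact integral_nonneg fun y =>
    ((isResolventBound_sampleWithout hz le_rfl x (r l)).posSemidef hz).nonneg_real _

theorem deltaVec_pi_le (hμ : ∀ l, MemLp id 2 (μ l)) (hz : 0 < z) (r : Fin k → Fin n)
    (hT : ∀ l, ∫ y, y.ofLp ⬝ᵥ y.ofLp ∂(μ l) ≤ T * n) (l : Fin k) :
    deltaVec (Measure.pi fun i => μ (cls i)) (fun i x => x i) μ r z l ≤ T / z := by
  have hn : (0 : ℝ) < n := by exact_mod_cast (r l).pos
  rw [deltaVec_pi_eq_integral hz]
  have hb := fun x : Fin n → EuclideanSpace ℝ (Fin p) =>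
    isResolventBound_sampleWithout hz le_rfl x (r l)
  have h1 : ∫ x, (popCov (μ l) * resolventMat (sampleCovWithout x (r l)) z).trace
      ∂(Measure.pi fun i => μ (cls i)) ≤ T * n / z := by
    refine (integral_mono (integrable_trace_mul (continuous_resolvent_sampleWithout hz (r l)) hz
      hb _).2 (integrable_const (T * n / z)) fun x => ?_).trans (by simp)
    simp only [trace_popCov_mul (hμ l)]
    exact integral_form_le hμ hz (hb x) (hT l)
  refine (mul_le_mul_of_nonneg_left h1 (by positivity)).trans (le_of_eq ?_)
  field_simp

/-- `δ` solves the system approximately. -/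
theorem abs_deltaVec_sub_deltaMap_le (h : ∀ l, HasLipschitzVariance (μ l) V) (hT0 : 0 ≤ T)
    (hT : ∀ l, ∫ y, y.ofLp ⬝ᵥ y.ofLp ∂(μ l) ≤ T * n) (hζ : 0 < ζ) (hz : ζ ≤ z)
    (r : Fin k → Fin n) (hr : ∀ l, cls (r l) = l) {e : ℝ}
    (he : ∀ l i, ∫ x, meanVec (μ l) ⬝ᵥ resolventMat (sampleCovWithout x i) z *ᵥ meanVec (μ l)
      ∂(Measure.pi fun i => μ (cls i)) ≤ e)
    (hδ : ∀ l, δ l = deltaVec (Measure.pi fun i => μ (cls i)) (fun i x => x i) μ r z l)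
    (l : Fin k) :
    n * |δ l - deltaMap μ cls z δ l| ≤ V / ζ +
      (V * T / ζ ^ 2 * √(T / ζ) * (k * √n) +
        V * T / ζ ^ 2 * (2 * V / ζ + 2 * V * √n / ζ + 2 * e) +
        V * √n / (ζ * √ζ) * (T + 2 * V / ζ)) + e +
      (1 + T / ζ) * (n / classSize cls l) := by
  have hμ := fun l => (h l).memLp_id
  have hz0 : 0 < z := hζ.trans_le hz
  have hn0 : 0 < n := (r l).pos
  have hn : (0 : ℝ) < n := by exact_mod_cast hn0
  have hV := (h l).nonneg
  have hδ0 : ∀ l, 0 ≤ δ l := fun l => by rw [hδ]; exact deltaVec_pi_nonneg hμ hz0 r l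
  have hδ1 : δ l ≤ T / ζ := by
    rw [hδ]; exact (deltaVec_pi_le hμ hz0 r hT l).trans (by gcongr)
  have hnδ : ∀ l, n * δ l = ∫ x, (popCov (μ l) * resolventMat (sampleCovWithout x (r l)) z).trace
      ∂(Measure.pi fun i => μ (cls i)) := fun l => by
    rw [hδ, deltaVec_pi_eq_integral hz0]; field_simp
  have hC := (h l).formBound
  have key := abs_integral_trace_sub_le (cls := cls) h hT0 hT hδ0 hζ hz hn0 hC hV
    -- `n δ_l` is exactly the mean of `tr(Σ_l Q_{-r l})`, so `η` is a concentration bound, applied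
    -- with removed index `i` instead of `r (cls i)`.
    (η := 2 * V / ζ + 2 * V * √n / ζ + 2 * e) fun i => by
      rw [hnδ]
      exact integral_abs_trace_popCov_sub_le (h (cls i)) hζ hz i (r (cls i)) (he (cls i))
  have hb := fun x : Fin n → EuclideanSpace ℝ (Fin p) =>
    isResolventBound_sampleWithout hζ hz x (r l)
  have hcA := continuous_resolvent_sampleWithout (p := p) hz0 (r l)
  have iP := (integrable_trace_mul (P := Measure.pi fun i => μ (cls i)) hcA hζ hb (popCov (μ l))).2
  have iC := (integrable_trace_mul (P := Measure.pi fun i => μ (cls i)) hcA hζ hb (covMat (μ l))).2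
  have iQ := (integrable_trace_mul (P := Measure.pi fun i => μ (cls i))
    (continuous_resolvent_sample (p := p) hz0) hζ
    (fun x => isResolventBound_sample hζ hz x) (covMat (μ l))).2
  have im : Integrable (fun x : Fin n → EuclideanSpace ℝ (Fin p) =>
      meanVec (μ l) ⬝ᵥ resolventMat (sampleCovWithout x (r l)) z *ᵥ meanVec (μ l))
      (Measure.pi fun i => μ (cls i)) := by
    refine (iP.sub iC).congr (Filter.Eventually.of_forall fun x => ?_)
    simp only [Pi.sub_apply, trace_popCov_mul_eq]; ring
  have e1 : n * δ l = ∫ x, (covMat (μ l) * resolventMat (sampleCovWithout x (r l)) z).trace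
      ∂(Measure.pi fun i => μ (cls i)) +
      ∫ x, meanVec (μ l) ⬝ᵥ resolventMat (sampleCovWithout x (r l)) z *ᵥ meanVec (μ l)
      ∂(Measure.pi fun i => μ (cls i)) := by
    rw [hnδ, ← integral_add iC im]
    simp_rw [trace_popCov_mul_eq]
  have e2 : n * deltaMap μ cls z δ l = (covMat (μ l) * tildeQ μ cls z δ).trace +
      meanVec (μ l) ⬝ᵥ tildeQ μ cls z δ *ᵥ meanVec (μ l) := by
    rw [← trace_popCov_mul_eq, deltaMap]; field_simp
  have b1 : |∫ x, (covMat (μ l) * resolventMat (sampleCovWithout x (r l)) z).trace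
      ∂(Measure.pi fun i => μ (cls i)) - ∫ x, (covMat (μ l) * resolventMat (sampleCov x) z).trace
      ∂(Measure.pi fun i => μ (cls i))| ≤ V / ζ := by
    rw [← integral_sub iC iQ]
    refine (abs_integral_le_integral_abs).trans ((integral_mono (iC.sub iQ).abs
      (integrable_const (V / ζ)) fun x =>
      abs_trace_sampleWithout_sub_le hC hV hζ hz x (r l)).trans (by simp))
  have b2 := he l (r l)
  have b3 : 0 ≤ ∫ x, meanVec (μ l) ⬝ᵥ resolventMat (sampleCovWithout x (r l)) z *ᵥ meanVec (μ l)
      ∂(Measure.pi fun i => μ (cls i)) :=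
    integral_nonneg fun x => ((hb x).posSemidef hζ).nonneg_real _
  have hl : 0 < classSize cls l := Finset.card_pos.2 ⟨r l, by simp [hr l]⟩
  have b4 := meanVec_form_tildeQ_le (cls := cls) hμ hδ0 hz0 hn0 l hl
  have b5 : (1 + δ l) * ((n : ℝ) / classSize cls l) ≤ (1 + T / ζ) * (n / classSize cls l) := by
    gcongr
  have b6 := ((isResolventBound_tildeQ (cls := cls) hμ hδ0 hz0).posSemidef hz0).nonneg_real
    (meanVec (μ l))
  rw [← abs_of_pos hn, ← abs_mul, mul_sub, abs_of_pos hn, e1, e2, abs_le]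
  obtain ⟨k1, k2⟩ := abs_le.1 key
  obtain ⟨c1, c2⟩ := abs_le.1 b1
  -- The errors are the passage from `Q_{-r}` to `Q` (`b1`), the trace comparison (`key`), and the
  -- two mean terms, which are nonnegative and bounded separately rather than compared.
  constructor <;> linarith

/-- The constant in the bound on the residual of `δ`. -/
noncomputable def residualConst (K V T ζ κ c : ℝ) : ℝ :=
  V / ζ + (V * T / ζ ^ 2 * √(T / ζ) * K + V * T / ζ ^ 2 * (2 * V / ζ + 2 * V / ζ + 2 * c) +
    V / (ζ * √ζ) * (T + 2 * V / ζ)) + c + (1 + T / ζ) * (1 / κ) + 1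

theorem residualConst_pos {K κ c : ℝ} (hK : 0 ≤ K) (hV : 0 ≤ V) (hT : 0 ≤ T) (hζ : 0 < ζ)
    (hκ : 0 < κ) (hc : 0 ≤ c) : 0 < residualConst K V T ζ κ c := by
  rw [residualConst]; positivity

/-- Here `s` stands for `√n` and `N` for `n / n_l`; since `s ≥ 1`, the bounded terms are absorbed
into multiples of `s`. -/
theorem residual_le {K κ c s : ℝ} (hV : 0 ≤ V) (hT : 0 ≤ T) (hζ : 0 < ζ)
    (hs : 1 ≤ s) (hk : (k : ℝ) ≤ K) {N : ℝ} (hN : N ≤ 1 / κ * s) :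
    V / ζ + (V * T / ζ ^ 2 * √(T / ζ) * (k * s) +
        V * T / ζ ^ 2 * (2 * V / ζ + 2 * V * s / ζ + 2 * (c * s)) +
        V * s / (ζ * √ζ) * (T + 2 * V / ζ)) + c * s + (1 + T / ζ) * N ≤
      residualConst K V T ζ κ c * s := by
  have hs0 : 0 ≤ s := by linarith
  have h1 : V / ζ ≤ V / ζ * s := le_mul_of_one_le_right (by positivity) hs
  have h2 : V * T / ζ ^ 2 * (2 * V / ζ) ≤ V * T / ζ ^ 2 * (2 * V / ζ) * s :=
    le_mul_of_one_le_right (by positivity) hs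
  have h3 : V * T / ζ ^ 2 * √(T / ζ) * (k * s) ≤ V * T / ζ ^ 2 * √(T / ζ) * (K * s) := by gcongr
  have h4 : (1 + T / ζ) * N ≤ (1 + T / ζ) * (1 / κ * s) :=
    mul_le_mul_of_nonneg_left hN (by positivity)
  have e : residualConst K V T ζ κ c * s = V / ζ * s + (V * T / ζ ^ 2 * √(T / ζ) * (K * s) +
      (V * T / ζ ^ 2 * (2 * V / ζ) * s + V * T / ζ ^ 2 * (2 * V * s / ζ + 2 * (c * s))) +
      V * s / (ζ * √ζ) * (T + 2 * V / ζ)) + c * s + (1 + T / ζ) * (1 / κ * s) + s := by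
    rw [residualConst]; ring
  rw [e]
  have e2 : V * T / ζ ^ 2 * (2 * V / ζ + 2 * V * s / ζ + 2 * (c * s)) =
    V * T / ζ ^ 2 * (2 * V / ζ) + V * T / ζ ^ 2 * (2 * V * s / ζ + 2 * (c * s)) := by ring
  rw [e2]
  linarith

theorem abs_deltaVec_sub_deltaMap_le_sqrt (h : ∀ l, HasLipschitzVariance (μ l) V) (hT0 : 0 ≤ T)
    (hT : ∀ l, ∫ y, y.ofLp ⬝ᵥ y.ofLp ∂(μ l) ≤ T * n) (hζ : 0 < ζ) (hz : ζ ≤ z)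
    (r : Fin k → Fin n) (hr : ∀ l, cls (r l) = l) {κ G K : ℝ} (hκ : 0 < κ)
    (hG : (p : ℝ) ≤ G * n) (hk : (k : ℝ) ≤ K) (hcls : ∀ l, κ * √n ≤ classSize cls l)
    (hκ2 : 2 ≤ κ * √n)
    (hδ : ∀ l, δ l = deltaVec (Measure.pi fun i => μ (cls i)) (fun i x => x i) μ r z l)
    (l : Fin k) :
    |δ l - deltaMap μ cls z δ l| ≤
      residualConst K V T ζ κ (4 / κ * (1 + V * G / ζ)) / √n := by
  have hn0 : 0 < n := (r l).pos
  have hn : (0 : ℝ) < n := by exact_mod_cast hn0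
  have hs : 0 < √(n : ℝ) := Real.sqrt_pos.2 hn
  have hss : √(n : ℝ) * √n = n := Real.mul_self_sqrt hn.le
  have hs1 : 1 ≤ √(n : ℝ) := by
    rw [Real.one_le_sqrt]; exact_mod_cast hn0
  have h1 := abs_deltaVec_sub_deltaMap_le (cls := cls) h hT0 hT hζ hz r hr
    (fun l i => integral_meanVec_form_le_sqrt (cls := cls) h hζ hz hκ hG l (hcls l) hκ2 i) hδ l
  have h2 : (n : ℝ) / classSize cls l ≤ 1 / κ * √n := by
    rw [div_le_iff₀ (by linarith [hcls l])]
    calc (n : ℝ) = 1 / κ * √n * (κ * √n) := by field_simp; rw [pow_two, hss]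
      _ ≤ _ := by gcongr; exact hcls l
  have h3 := h1.trans (residual_le (h l).nonneg hT0 hζ hs1 hk h2)
  rw [le_div_iff₀ hs]
  refine le_of_mul_le_mul_right ?_ hs
  rw [mul_assoc, hss]
  linarith

end Conclusion

/-! ### Choice of constants and assembly. -/

theorem mainTheorem5 (K : ℕ) (C c q B G Z κ : ℝ) (hC : Real.exp 1 ≤ C) (hc : 0 < c)
    (hq : 0 < q) (hκ : 0 < κ) :
    ∃ A : ℝ, 0 < A ∧ ∃ N : ℕ, ∀ k p n : ℕ, k ≤ K → N ≤ n → 1 + (p : ℝ) / (n : ℝ) ≤ G →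
      ∀ z₀ z : ℝ, 0 < z₀ → z₀ < 1 → 1 / z₀ ≤ Z → z₀ ≤ z →
      ∀ (μ : Fin k → Measure (EuclideanSpace ℝ (Fin p))),
      (∀ l, IsProbabilityMeasure (μ l)) →
      (∀ l, IidConvexExpConcentrated (μ l) C c q) →
      ((∀ l, (∫ y, ‖y‖ ∂(μ l)) ≤ B * √(p : ℝ)) ∨
        (2 ≤ q ∧ ∀ l, ‖∫ y, y ∂(μ l)‖ ≤ B * √(p : ℝ))) →
      ∀ (cls : Fin n → Fin k), (∀ l, κ * √(n : ℝ) ≤ (classSize cls l : ℝ)) →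
      ∀ (Ω : Type u) [MeasurableSpace Ω] (P : Measure Ω) [IsProbabilityMeasure P]
        (x : Fin n → Ω → EuclideanSpace ℝ (Fin p)),
      (∀ i, HasLaw (x i) (μ (cls i)) P) → iIndepFun x P →
      ∀ (r : Fin k → Fin n), (∀ l, cls (r l) = l) →
      ∃ δ' : Fin k → ℝ, IsDeltaPrime μ cls z δ' ∧ (∀ d, IsDeltaPrime μ cls z d → d = δ') ∧
        ‖deltaVec P x μ r z - δ'‖ ≤ A / √(n : ℝ) ∧
        spectralNorm₂ (tildeQ μ cls z (deltaVec P x μ r z) - tildeQ μ cls z δ') ≤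
          A / √(n : ℝ) := by
  obtain ⟨V, hV0, hV⟩ := exists_lipschitzVariance C c q ((Real.exp_pos 1).le.trans hC) hc hq
  -- A positive lower bound for `z₀`, hence for `z`, that depends on `Z` only.
  set ζ : ℝ := 1 / max Z 1 with hζdef
  have hζ : 0 < ζ := by positivity
  set G' : ℝ := max G 0 with hG'
  have hG0 : 0 ≤ G' := le_max_right _ _
  -- `E|y|² ≤ (V + B²) p` and `p ≤ G' n` give `E|y|² ≤ T n`.
  set T : ℝ := (V + B ^ 2) * G' with hTdef
  have hT0 : 0 ≤ T := by positivity
  set A₀ : ℝ := residualConst K V T ζ κ (4 / κ * (1 + V * G' / ζ)) with hA₀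
  have hA₀0 : 0 < A₀ :=
    residualConst_pos (Nat.cast_nonneg K) hV0 hT0 hζ hκ (by positivity)
  -- The first summand serves the bound on `δ - δ'`, the second the spectral norm.
  set A : ℝ := 2 * A₀ * (1 + T / ζ) + 2 * A₀ / ζ with hA
  have hA0 : 0 < A := by positivity
  -- `√n ≥ 2A₀` makes the residual `A₀/√n` at most `1/2`, as stability requires; `√n ≥ 2/κ` gives
  -- `κ√n ≥ 2`, so that classes survive the removal of a column.
  refine ⟨A, hA0, max 1 ⌈(max (2 * A₀) (2 / κ)) ^ 2⌉₊, ?_⟩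
  intro k p n hkK hN hG z₀ z hz₀ hz₀1 hZ hz₀z μ hprob hconc hmean cls hcls Ω _ P _ x hx hind r hr
  have hn0 : 0 < n := lt_of_lt_of_le one_pos ((le_max_left _ _).trans hN)
  have hn : (0 : ℝ) < n := by exact_mod_cast hn0
  have hs : 0 < √(n : ℝ) := Real.sqrt_pos.2 hn
  have hsN : max (2 * A₀) (2 / κ) ≤ √(n : ℝ) := by
    apply Real.le_sqrt_of_sq_le
    exact (Nat.le_ceil _).trans (by exact_mod_cast (le_max_right _ _).trans hN)
  have hsA : 2 * A₀ ≤ √(n : ℝ) := (le_max_left _ _).trans hsN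
  have hsκ : 2 ≤ κ * √(n : ℝ) := by
    have := (le_max_right _ _).trans hsN
    rwa [div_le_iff₀' hκ] at this
  have hζz : ζ ≤ z := by
    refine le_trans ?_ hz₀z
    rw [hζdef, div_le_iff₀ (by positivity)]
    rw [div_le_iff₀ hz₀] at hZ
    nlinarith [le_max_left Z 1]
  have hz0 : 0 < z := hζ.trans_le hζz
  have hpG : (p : ℝ) ≤ G' * n := by
    have h1 : (p : ℝ) / n ≤ G' := by linarith [le_max_left G 0]
    rwa [div_le_iff₀ hn] at h1
  have hlv : ∀ l, HasLipschitzVariance (μ l) V := fun l => hV p (μ l) (hconc l)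
  have hμ := fun l => (hlv l).memLp_id
  -- Both alternatives yield a bound on the norm of the mean, the first by the triangle inequality
  -- for integrals.
  have hmean' : ∀ l, ‖∫ y, y ∂(μ l)‖ ≤ B * √(p : ℝ) := by
    rcases hmean with h | h
    · exact fun l => (norm_integral_le_integral_norm _).trans (h l)
    · exact h.2
  have hT : ∀ l, ∫ y, y.ofLp ⬝ᵥ y.ofLp ∂(μ l) ≤ T * n := fun l => by
    refine ((hlv l).integral_dotProduct_self_le (hmean' l)).trans ?_
    rw [hTdef, mul_assoc]
    exact mul_le_mul_of_nonneg_left hpG (by positivity)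
  obtain ⟨δ', hδ'⟩ := exists_isDeltaPrime (cls := cls) hμ hz0 hn0 hT0 hT
  refine ⟨δ', hδ', fun d hd => isDeltaPrime_unique hμ hz0 hd hδ', ?_⟩
  rw [deltaVec_eq_pi hx hind hz0 r]
  set δ := deltaVec (Measure.pi fun i => μ (cls i)) (fun i x => x i) μ r z with hδ
  have hδ0 : ∀ l, 0 ≤ δ l := deltaVec_pi_nonneg hμ hz0 r
  have hTz : T / z ≤ T / ζ := by gcongr
  have hδT : ∀ l, δ l ≤ T / ζ := fun l => (deltaVec_pi_le hμ hz0 r hT l).trans hTz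
  have hδ'T : ∀ l, δ' l ≤ T / ζ := fun l => by
    rw [(isDeltaPrime_iff.1 hδ').2 l]
    exact (deltaMap_le hμ hδ'.1 hz0 hn0 l (hT l)).trans hTz
  have happrox : ∀ l, |δ l - deltaMap μ cls z δ l| ≤ A₀ / √n :=
    abs_deltaVec_sub_deltaMap_le_sqrt (cls := cls) hlv hT0 hT hζ hζz r hr hκ hpG
      (by exact_mod_cast hkK) hcls hsκ fun _ => rfl
  have hε : A₀ / √(n : ℝ) ≤ 1 / 2 := by
    rw [div_le_iff₀ hs]; linarith
  have hstab := one_add_le_of_approx hμ hz0 hδ0 hδ' (by positivity) hε happrox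
  have hTζ : 0 ≤ T / ζ := by positivity
  constructor
  · rw [pi_norm_le_iff_of_nonneg (by positivity)]
    -- The multiplicative comparison becomes additive because `δ` and `δ'` are both at most `T/ζ`.
    intro l
    have h1 := hstab l
    have e0 : 0 ≤ 2 * (A₀ / √(n : ℝ)) := by positivity
    have h2 := mul_le_mul_of_nonneg_left (add_le_add_right (hδT l) 1) e0
    have h3 := mul_le_mul_of_nonneg_left (add_le_add_right (hδ'T l) 1) e0
    have h4 : 2 * (A₀ / √(n : ℝ)) * (1 + T / ζ) ≤ A / √n := by
      rw [hA, add_div]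
      have : 0 ≤ 2 * A₀ / ζ / √(n : ℝ) := by positivity
      have e1 : 2 * (A₀ / √(n : ℝ)) * (1 + T / ζ) = 2 * A₀ * (1 + T / ζ) / √(n : ℝ) := by ring
      linarith
    rw [Pi.sub_apply, Real.norm_eq_abs, abs_le]
    constructor <;> linarith
  · refine (spectralNorm₂_tildeQ_sub_le (cls := cls) hμ hz0 hδ0 hδ'.1
      (ε := 2 * (A₀ / √(n : ℝ))) (by positivity) hstab).trans ?_
    calc 2 * (A₀ / √(n : ℝ)) / z ≤ 2 * (A₀ / √(n : ℝ)) / ζ := by gcongr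
      _ = 2 * A₀ / ζ / √(n : ℝ) := by ring
      _ ≤ A / √(n : ℝ) := by
        rw [hA]
        gcongr
        have : 0 ≤ 2 * A₀ * (1 + T / ζ) := by positivity
        linarith
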